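/- Let $X$ be a connected complex projective manifold of dimension $n$ and let $D=\sum_j c_jD_j$ be an orbifold divisor on $X$: a finite sum over distinct irreducible hypersurfaces $D_j$, with $c_j\in\,]0,1]\cap\mathbb Q$, whose support has simple normal crossings. Local holomorphic coordinates $(x_1,\dots,x_n)$ on $X$ are called adapted to $D$ if in them $D=\sum_{i=1}^n c_iH_i$, where $H_i=\{x_i=0\}$ and $c_i\in[0,1]\cap\mathbb Q$ (with $c_i=0$ if $H_i$ is not a component of $D$). For $m>0$, let $[\otimes^m]\Omega^1(X,D)$ be the sheaf of $\mathcal O_X$-modules (of meromorphic covariant $m$-tensors on $X$ with poles along $\mathrm{Supp}(D)$) which, in adapted coordinates, is generated by the $n^m$ tensors $$t_h=\Big(\prod_{i=1}^n x_i^{-\lfloor m_ic_i\rfloor}\Big)\,dx_{h(1)}\otimes\cdots\otimes dx_{h(m)},\qquad h:\{1,\dots,m\}\to\{1,\dots,n\},\quad m_i=\#h^{-1}(i).$$ Let $\pi:Y\to X$ be a Kawamata cover adapted to $(X,D)$, with finite group $G$: $Y$ is a connected complex manifold with a faithful holomorphic action of $G$, $\pi$ is a finite surjective holomorphic map whose fibres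 are exactly the $G$-orbits, and near every point of $Y$ there are coordinates $(y_1,\dots,y_n)$ on $Y$ and coordinates $(x_1,\dots,x_n)$ on $X$, adapted to $D$, in which $\pi$ is given by $x_i=y_i^{k_i}$ with integers $k_i>0$ divisible by the denominator of $c_i$ (so that $k_ic_i\in\mathbb Z$). Let $\pi^*\Omega^1(X,D)$ be the locally free sheaf on $Y$ generated in such coordinates by the meromorphic $1$-forms $\pi^*(dx_i/x_i^{c_i}):=y_i^{-k_ic_i}\,\pi^*(dx_i)$, $1\le i\le n$, and let $\otimes^m(\pi^*\Omega^1(X,D))$ be its $m$-th tensor power, generated by the $m$-fold tensor products of these forms, on which $G$ acts by pullback. Let $\pi_*^G(\otimes^m(\pi^*\Omega^1(X,D)))$ be the sheaf of $\mathcal O_X$-modules $U\mapsto H^0(\pi^{-1}(U),\otimes^m(\pi^*\Omega^1(X,D)))^G$. Then, for every $m>0$: 1. $[\otimes^m]\Omega^1(X,D)$ is well defined and locally free: on the domain of any adapted coordinate system, it is free with basis the $n^m$ tensors $t_h$. 2. $[\otimes^m]\Omega^1(X,D)=\pi_*^G(\otimes^m(\pi^*\Omega^1(X,D)))$. That is,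 for every open $U\subset X$, the pullback $\pi^*$ of tensors is an injective $\mathcal O_X(U)$-linear map on $H^0(U,[\otimes^m]\Omega^1(X,D))$, with image $H^0(\pi^{-1}(U),\otimes^m(\pi^*\Omega^1(X,D)))^G$. -/

import Mathlib

open scoped Manifold ContDiff Topology
open TopologicalSpace Filter

noncomputable section

namespace Orbifold

/-! Complex manifolds of dimension `n` are charted spaces over `Fin n → ℂ` with analytic changes of
charts. Holomorphic maps between them are the complex differentiable ones. -/

section Tensors

variable {n : ℕ} {M : Type*} [TopologicalSpace M] [ChartedSpace (Fin n → ℂ) M]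

theorem mdifferentiableAt_restrict_iff {U : Opens M} {f : M → ℂ} {x : U} :
    MDifferentiableAt 𝓘(ℂ, Fin n → ℂ) 𝓘(ℂ, ℂ) (fun z : U => f z) x ↔
      MDifferentiableAt 𝓘(ℂ, Fin n → ℂ) 𝓘(ℂ, ℂ) f (x : M) := by
  exact ((differentiableWithinAt_localInvariantProp (I := 𝓘(ℂ, Fin n → ℂ))
    (I' := 𝓘(ℂ, ℂ))).liftPropAt_iff_comp_subtype_val f x).symm

/-- The ring `𝒪(U)` of holomorphic functions on an open subset `U` of a complex manifold. -/
def holo (n : ℕ) {M : Type*} [TopologicalSpace M] [ChartedSpace (Fin n → ℂ) M] (U : Opens M) :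
    Subring (U → ℂ) where
  carrier := {f | MDifferentiable 𝓘(ℂ, Fin n → ℂ) 𝓘(ℂ, ℂ) f}
  mul_mem' hf hg := fun x => (hf x).mul (hg x)
  one_mem' := mdifferentiable_const
  add_mem' hf hg := fun x => (hf x).add (hg x)
  zero_mem' := mdifferentiable_const
  neg_mem' hf := fun x => (hf x).neg

theorem exists_extension {U : Opens M} (g : holo n U) :
    ∃ F : M → ℂ, (∀ x (hx : x ∈ U), F x = (g : U → ℂ) ⟨x, hx⟩) ∧
      ∀ x ∈ U, MDifferentiableAt 𝓘(ℂ, Fin n → ℂ) 𝓘(ℂ, ℂ) F x := by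
  classical
  have key : ∀ x (hx : x ∈ U),
      (fun x => if h : x ∈ U then (g : U → ℂ) ⟨x, h⟩ else 0) x = (g : U → ℂ) ⟨x, hx⟩ :=
    fun x hx => by simp [hx]
  refine ⟨fun x => if h : x ∈ U then (g : U → ℂ) ⟨x, h⟩ else 0, key, fun x hx => ?_⟩
  have h1 := g.2 ⟨x, hx⟩
  refine (mdifferentiableAt_restrict_iff (x := (⟨x, hx⟩ : U))).1 ?_
  convert h1 using 1
  funext z
  exact key z z.2

/-- Covariant `m`-tensors at `x`: elements of `⊗^m T*ₓM`, seen as `m`-linear forms on `TₓM`. -/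
abbrev CoTensor (n m : ℕ) {M : Type*} [TopologicalSpace M] [ChartedSpace (Fin n → ℂ) M] (x : M) :
    Type :=
  ContinuousMultilinearMap ℂ (fun _ : Fin m => TangentSpace 𝓘(ℂ, Fin n → ℂ) x) ℂ

/-- The tensor product `α 0 ⊗ ⋯ ⊗ α (m - 1)` of `m` cotangent vectors at `x`. -/
def tensorOf {m : ℕ} {x : M} (α : Fin m → (TangentSpace 𝓘(ℂ, Fin n → ℂ) x →L[ℂ] ℂ)) :
    CoTensor n m x :=
  (ContinuousMultilinearMap.mkPiAlgebra ℂ (Fin m) ℂ).compContinuousLinearMap α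

/-- The differential at `x` of the `i`-th coordinate function of the chart `φ`. -/
def dcoord (φ : OpenPartialHomeomorph M (Fin n → ℂ)) (i : Fin n) (x : M) :
    TangentSpace 𝓘(ℂ, Fin n → ℂ) x →L[ℂ] ℂ :=
  mfderiv 𝓘(ℂ, Fin n → ℂ) 𝓘(ℂ, ℂ) (fun z => φ z i) x

/-- (Not necessarily continuous) covariant `m`-tensor fields on `U ∖ Z`. The sheaves considered
below consist of sections over `U` with poles along a hypersurface `Z`; since `U ∖ Z` is dense in
`U`, such a section is given by its values on `U ∖ Z`. -/
def TensorField (n m : ℕ) {M : Type*} [TopologicalSpace M] [ChartedSpace (Fin n → ℂ) M]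
    (Z : Set M) (U : Opens M) : Type _ :=
  (x : {x : M // x ∈ U ∧ x ∉ Z}) → CoTensor n m (x : M)

instance {m : ℕ} {Z : Set M} {U : Opens M} : AddCommGroup (TensorField n m Z U) :=
  inferInstanceAs (AddCommGroup ((x : {x : M // x ∈ U ∧ x ∉ Z}) → CoTensor n m (x : M)))

/-- `𝒪(U)` acts on tensor fields on `U ∖ Z` by pointwise multiplication. -/
instance {m : ℕ} {Z : Set M} {U : Opens M} : Module (holo n U) (TensorField n m Z U) where
  smul g s := fun x => (g : U → ℂ) ⟨x, x.2.1⟩ • s x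
  one_smul s := funext fun x => one_smul ℂ (s x)
  mul_smul g g' s := funext fun x =>
    mul_smul ((g : U → ℂ) ⟨x, x.2.1⟩) ((g' : U → ℂ) ⟨x, x.2.1⟩) (s x)
  smul_zero g := funext fun x =>
    smul_zero (A := CoTensor n m (x : M)) ((g : U → ℂ) ⟨x, x.2.1⟩)
  smul_add g s s' := funext fun x => smul_add ((g : U → ℂ) ⟨x, x.2.1⟩) (s x) (s' x)
  add_smul g g' s := funext fun x =>
    add_smul ((g : U → ℂ) ⟨x, x.2.1⟩) ((g' : U → ℂ) ⟨x, x.2.1⟩) (s x)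
  zero_smul s := funext fun x => zero_smul ℂ (s x)

/-- Near the point `p`, the tensor field `s` is a combination, with holomorphic coefficients, of
the family of tensor fields `t`. -/
def LocallyGenerated {m : ℕ} {Z : Set M} {U : Opens M} {ι : Type} [Fintype ι]
    (t : ι → (x : M) → CoTensor n m x) (s : TensorField n m Z U) (p : M) : Prop :=
  ∃ f : ι → M → ℂ, ∀ᶠ x in 𝓝 p,
    (∀ h, MDifferentiableAt 𝓘(ℂ, Fin n → ℂ) 𝓘(ℂ, ℂ) (f h) x) ∧
      ∀ hx : x ∈ U ∧ x ∉ Z, s ⟨x, hx⟩ = ∑ h, f h x • t h x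

section LocallyGenerated

variable {m : ℕ} {Z : Set M} {U : Opens M} {ι : Type} [Fintype ι]
  {t : ι → (x : M) → CoTensor n m x} {p : M}

theorem LocallyGenerated.zero : LocallyGenerated t (0 : TensorField n m Z U) p :=
  ⟨fun _ _ => 0, Eventually.of_forall fun x => ⟨fun _ => mdifferentiableAt_const, fun _ =>
    (Finset.sum_eq_zero fun h _ => zero_smul ℂ (t h x)).symm⟩⟩

theorem LocallyGenerated.add {s s' : TensorField n m Z U} (hs : LocallyGenerated t s p)
    (hs' : LocallyGenerated t s' p) : LocallyGenerated t (s + s') p := by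
  obtain ⟨f, hf⟩ := hs
  obtain ⟨f', hf'⟩ := hs'
  refine ⟨fun h x => f h x + f' h x, ?_⟩
  filter_upwards [hf, hf'] with x hx hx'
  refine ⟨fun h => (hx.1 h).add (hx'.1 h), fun hxU => ?_⟩
  change s ⟨x, hxU⟩ + s' ⟨x, hxU⟩ = _
  rw [hx.2 hxU, hx'.2 hxU, ← Finset.sum_add_distrib]
  exact Finset.sum_congr rfl fun h _ => (add_smul _ _ _).symm

theorem LocallyGenerated.smul_of_eventually {s s' : TensorField n m Z U} {F : M → ℂ}
    (hF : ∀ᶠ x in 𝓝 p, MDifferentiableAt 𝓘(ℂ, Fin n → ℂ) 𝓘(ℂ, ℂ) F x)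
    (h' : ∀ x (hx : x ∈ U ∧ x ∉ Z), s' ⟨x, hx⟩ = F x • s ⟨x, hx⟩)
    (hs : LocallyGenerated t s p) : LocallyGenerated t s' p := by
  obtain ⟨f, hf⟩ := hs
  refine ⟨fun h x => F x * f h x, ?_⟩
  filter_upwards [hf, hF] with x hx hFx
  refine ⟨fun h => hFx.mul (hx.1 h), fun hxU => ?_⟩
  rw [h', hx.2 hxU, Finset.smul_sum]
  exact Finset.sum_congr rfl fun h _ => (mul_smul _ _ _).symm

theorem LocallyGenerated.smul (hp : p ∈ U) (g : holo n U) {s : TensorField n m Z U}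
    (hs : LocallyGenerated t s p) : LocallyGenerated t (g • s) p := by
  obtain ⟨F, hF, hFd⟩ := exists_extension g
  refine hs.smul_of_eventually (F := F) ?_ fun x hx => ?_
  · filter_upwards [U.isOpen.mem_nhds hp] with x hx using hFd x hx
  · rw [hF x hx.1]; rfl

end LocallyGenerated

end Tensors

section Pairs

variable {n : ℕ} {X : Type*} [TopologicalSpace X] [ChartedSpace (Fin n → ℂ) X]

/-- `φ` is a holomorphic coordinate system in which the members of the family `comp` that meet its
domain are distinct coordinate hyperplanes: `label i = some j` means that `{φᵢ = 0}` is
`comp j`, and `label i = none` means that `{φᵢ = 0}` is not in the family. -/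
structure IsSNCChart {ι : Type} (comp : ι → Set X) (φ : OpenPartialHomeomorph X (Fin n → ℂ))
    (label : Fin n → Option ι) : Prop where
  mem_atlas : φ ∈ IsManifold.maximalAtlas 𝓘(ℂ, Fin n → ℂ) ω X
  label_inj : ∀ i i' j, label i = some j → label i' = some j → i = i'
  hyperplane : ∀ i j, label i = some j → φ.source ∩ comp j = {x ∈ φ.source | φ x i = 0}
  label_surj : ∀ j, (φ.source ∩ comp j).Nonempty → ∃ i, label i = some j

/-- An orbifold divisor `D = ∑ⱼ cⱼ Dⱼ`, `cⱼ ∈ (0, 1] ∩ ℚ`, whose support has simple normal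
crossings: the `Dⱼ` are finitely many distinct closed connected hypersurfaces which, near every
point, are distinct coordinate hyperplanes. -/
structure SmoothOrbifoldDivisor (n : ℕ) (X : Type*) [TopologicalSpace X]
    [ChartedSpace (Fin n → ℂ) X] where
  numComp : ℕ
  comp : Fin numComp → Set X
  coeff : Fin numComp → ℚ
  coeff_pos : ∀ j, 0 < coeff j
  coeff_le_one : ∀ j, coeff j ≤ 1
  comp_closed : ∀ j, IsClosed (comp j)
  comp_connected : ∀ j, IsConnected (comp j)
  comp_injective : Function.Injective comp
  snc : ∀ x : X, ∃ (φ : OpenPartialHomeomorph X (Fin n → ℂ))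
    (label : Fin n → Option (Fin numComp)), IsSNCChart comp φ label ∧ x ∈ φ.source

namespace SmoothOrbifoldDivisor

variable (D : SmoothOrbifoldDivisor n X)

/-- The support of `D`. -/
def support : Set X := ⋃ j, D.comp j

/-- Coordinates `x₁, …, xₙ` on `X` adapted to `D`. -/
abbrev IsAdapted (φ : OpenPartialHomeomorph X (Fin n → ℂ))
    (label : Fin n → Option (Fin D.numComp)) : Prop :=
  IsSNCChart D.comp φ label

/-- The coefficient `cᵢ` in `D` of the `i`-th coordinate hyperplane of an adapted chart. -/
def weight (label : Fin n → Option (Fin D.numComp)) (i : Fin n) : ℚ :=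
  (label i).elim 0 D.coeff

/-- For `h : {1,…,m} → {1,…,n}` (that is, a partition of `{1,…,m}` into the sets `Mᵢ = h⁻¹(i)`, of
cardinality `mᵢ`), the tensor `∏ᵢ xᵢ^(-⌊mᵢ cᵢ⌋) dx_{h(1)} ⊗ ⋯ ⊗ dx_{h(m)}`. -/
def frame (φ : OpenPartialHomeomorph X (Fin n → ℂ)) (label : Fin n → Option (Fin D.numComp))
    {m : ℕ} (h : Fin m → Fin n) (x : X) : CoTensor n m x :=
  (∏ i, (φ x i)⁻¹ ^ ⌊(Fintype.card {k // h k = i} : ℚ) * D.weight label i⌋₊) •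
    tensorOf fun k => dcoord φ (h k) x

/-- The restriction to `V ∖ Supp D` of the tensor `frame φ label h`. -/
def frameOn (φ : OpenPartialHomeomorph X (Fin n → ℂ)) (label : Fin n → Option (Fin D.numComp))
    {m : ℕ} (h : Fin m → Fin n) (V : Opens X) : TensorField n m D.support V :=
  fun x => D.frame φ label h x

/-- The sections over `U` of the sheaf `[⊗^m]Ω¹(X, D)`: in all adapted coordinates, they are locally
the combinations of the tensors `frame φ label h` with holomorphic coefficients. -/
def integralTensors (m : ℕ) (U : Opens X) :
    Submodule (holo n U) (TensorField n m D.support U) where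
  carrier := {s | ∀ φ label, D.IsAdapted φ label → ∀ x ∈ φ.source, x ∈ U →
    LocallyGenerated (fun h : Fin m → Fin n => D.frame φ label h) s x}
  zero_mem' := fun _ _ _ _ _ _ => .zero
  add_mem' hs hs' := fun φ label hφ x hx hxU =>
    (hs φ label hφ x hx hxU).add (hs' φ label hφ x hx hxU)
  smul_mem' g _ hs := fun φ label hφ x hx hxU => (hs φ label hφ x hx hxU).smul hxU g

end SmoothOrbifoldDivisor

/-- The compact complex manifold `X` is projective: it has an injective holomorphic immersion into
some `ℙ^N`. Such a map `F` is given locally by a nowhere zero holomorphic `s` with values in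
`ℂ^(N+1)`; it is an immersion at `x` when no nonzero tangent vector is mapped by `ds` into the line
spanned by `s x`. -/
def IsProjective (n : ℕ) (X : Type*) [TopologicalSpace X] [ChartedSpace (Fin n → ℂ) X] : Prop :=
  ∃ (N : ℕ) (F : X → Projectivization ℂ (Fin (N + 1) → ℂ)), Function.Injective F ∧
    ∀ x : X, ∃ s : X → (Fin (N + 1) → ℂ),
      (∀ᶠ z in 𝓝 x, MDifferentiableAt 𝓘(ℂ, Fin n → ℂ) 𝓘(ℂ, Fin (N + 1) → ℂ) s z ∧
        ∃ hz : s z ≠ 0, F z = Projectivization.mk ℂ (s z) hz) ∧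
      ∀ v : TangentSpace 𝓘(ℂ, Fin n → ℂ) x,
        (mfderiv 𝓘(ℂ, Fin n → ℂ) 𝓘(ℂ, Fin (N + 1) → ℂ) s x v : Fin (N + 1) → ℂ) ∈
          Submodule.span ℂ {s x} → v = 0

variable {Y : Type*} [TopologicalSpace Y] [ChartedSpace (Fin n → ℂ) Y]

/-- In the coordinates `ψ` on `Y` and `φ` on `X`, the latter adapted to `D`, the map `π` is the
Kummer map `xᵢ = yᵢ^(kᵢ)`, with `kᵢ` divisible by the denominator of the coefficient of
`{xᵢ = 0}` in `D`. -/
structure IsKummerPair (D : SmoothOrbifoldDivisor n X) (π : Y → X)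
    (ψ : OpenPartialHomeomorph Y (Fin n → ℂ)) (φ : OpenPartialHomeomorph X (Fin n → ℂ))
    (label : Fin n → Option (Fin D.numComp)) (k : Fin n → ℕ) : Prop where
  mem_atlas : ψ ∈ IsManifold.maximalAtlas 𝓘(ℂ, Fin n → ℂ) ω Y
  adapted : D.IsAdapted φ label
  mapsTo : Set.MapsTo π ψ.source φ.source
  kummer : ∀ y ∈ ψ.source, ∀ i, φ (π y) i = ψ y i ^ k i
  exponent_pos : ∀ i, 0 < k i
  den_dvd : ∀ i, (D.weight label i).den ∣ k i

/-- Kawamata covers `π : Y → X` adapted to `(X, D)`, with group `G`: finite Galois covers, with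
`X = Y / G`, which are locally Kummer maps as in `IsKummerPair`. (Finite means proper with finite
fibres; the fibres are the orbits of the finite group `G`.) -/
structure KawamataCover (D : SmoothOrbifoldDivisor n X) (Y : Type*) [TopologicalSpace Y]
    [ChartedSpace (Fin n → ℂ) Y] (G : Type*) [Group G] [MulAction G Y] where
  toFun : Y → X
  holomorphic : MDifferentiable 𝓘(ℂ, Fin n → ℂ) 𝓘(ℂ, Fin n → ℂ) toFun
  proper : IsProperMap toFun
  surjective : Function.Surjective toFun
  eq_iff_orbit : ∀ y y', toFun y = toFun y' ↔ ∃ g : G, g • y = y'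
  smul_holomorphic : ∀ g : G,
    MDifferentiable 𝓘(ℂ, Fin n → ℂ) 𝓘(ℂ, Fin n → ℂ) (fun y : Y => g • y)
  faithful : ∀ g : G, (∀ y : Y, g • y = y) → g = 1
  locally_kummer : ∀ y : Y, ∃ ψ φ label k, IsKummerPair D toFun ψ φ label k ∧ y ∈ ψ.source

namespace KawamataCover

variable {D : SmoothOrbifoldDivisor n X} {G : Type*} [Group G] [MulAction G Y]
  (K : KawamataCover D Y G)

/-- The open set `π⁻¹(U)`. -/
def preimage (U : Opens X) : Opens Y := ⟨K.toFun ⁻¹' U, U.isOpen.preimage K.proper.continuous⟩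

/-- The pole divisor upstairs, `π⁻¹(Supp D)`. -/
def support : Set Y := K.toFun ⁻¹' D.support

/-- The local generators of `π^*Ω¹(X, D)` in Kummer coordinates: the `1`-form
`π^*(dxᵢ / xᵢ^cᵢ) = yᵢ^(-kᵢ cᵢ) π^*(dxᵢ)`, where `kᵢ cᵢ` is an integer. -/
def coframe (ψ : OpenPartialHomeomorph Y (Fin n → ℂ)) (φ : OpenPartialHomeomorph X (Fin n → ℂ))
    (label : Fin n → Option (Fin D.numComp)) (k : Fin n → ℕ) (i : Fin n) (y : Y) :
    TangentSpace 𝓘(ℂ, Fin n → ℂ) y →L[ℂ] ℂ :=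
  (ψ y i)⁻¹ ^ ⌊(k i : ℚ) * D.weight label i⌋₊ •
    (dcoord φ i (K.toFun y)).comp (mfderiv 𝓘(ℂ, Fin n → ℂ) 𝓘(ℂ, Fin n → ℂ) K.toFun y)

/-- The sections over `V` of the sheaf `⊗^m π^*Ω¹(X, D)` on `Y`: in all Kummer coordinates, they are
locally the combinations of the `m`-fold tensor products of the generators of `π^*Ω¹(X, D)`, with
holomorphic coefficients. -/
def orbifoldTensors (m : ℕ) (V : Opens Y) :
    Submodule (holo n V) (TensorField n m K.support V) where
  carrier := {s | ∀ ψ φ label k, IsKummerPair D K.toFun ψ φ label k → ∀ y ∈ ψ.source, y ∈ V →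
    LocallyGenerated
      (fun (h : Fin m → Fin n) z => tensorOf fun a => K.coframe ψ φ label k (h a) z) s y}
  zero_mem' := fun _ _ _ _ _ _ _ _ => .zero
  add_mem' hs hs' := fun ψ φ label k hk y hy hyV =>
    (hs ψ φ label k hk y hy hyV).add (hs' ψ φ label k hk y hy hyV)
  smul_mem' g _ hs := fun ψ φ label k hk y hy hyV => (hs ψ φ label k hk y hy hyV).smul hyV g

/-- Tensor fields on `π⁻¹(U) ∖ π⁻¹(Supp D)`, as an `𝒪(U)`-module through `π`. -/
def Pushforward (m : ℕ) (U : Opens X) : Type _ := TensorField n m K.support (K.preimage U)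

instance {m : ℕ} {U : Opens X} : AddCommGroup (K.Pushforward m U) :=
  inferInstanceAs (AddCommGroup (TensorField n m K.support (K.preimage U)))

instance {m : ℕ} {U : Opens X} : Module (holo n U) (K.Pushforward m U) where
  smul g s := fun y => (g : U → ℂ) ⟨K.toFun y, y.2.1⟩ • s y
  one_smul s := funext fun y => one_smul ℂ (s y)
  mul_smul g g' s := funext fun y =>
    mul_smul ((g : U → ℂ) ⟨K.toFun y, y.2.1⟩) ((g' : U → ℂ) ⟨K.toFun y, y.2.1⟩) (s y)
  smul_zero g := funext fun y =>
    smul_zero (A := CoTensor n m (y : Y)) ((g : U → ℂ) ⟨K.toFun y, y.2.1⟩)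
  smul_add g s s' := funext fun y => smul_add ((g : U → ℂ) ⟨K.toFun y, y.2.1⟩) (s y) (s' y)
  add_smul g g' s := funext fun y =>
    add_smul ((g : U → ℂ) ⟨K.toFun y, y.2.1⟩) ((g' : U → ℂ) ⟨K.toFun y, y.2.1⟩) (s y)
  zero_smul s := funext fun y => zero_smul ℂ (s y)

/-- `s` is `G`-invariant: `g^* s = s` for all `g`, where `g^*` is the pullback of tensors. -/
def IsInvariant {m : ℕ} {U : Opens X} (s : K.Pushforward m U) : Prop :=
  ∀ (g : G) (y : Y) (hy : y ∈ K.preimage U ∧ y ∉ K.support)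
    (hgy : g • y ∈ K.preimage U ∧ g • y ∉ K.support),
    (s ⟨g • y, hgy⟩).compContinuousLinearMap
      (fun _ => mfderiv 𝓘(ℂ, Fin n → ℂ) 𝓘(ℂ, Fin n → ℂ) (fun z : Y => g • z) y) = s ⟨y, hy⟩

/-- The sections over `U` of the sheaf `π_*^G(⊗^m π^*Ω¹(X, D))` on `X`, that is
`H⁰(π⁻¹(U), ⊗^m π^*Ω¹(X, D))^G`. -/
def invariantTensors (m : ℕ) (U : Opens X) : Submodule (holo n U) (K.Pushforward m U) where
  carrier := {s | s ∈ K.orbifoldTensors m (K.preimage U) ∧ K.IsInvariant s}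
  zero_mem' := ⟨Submodule.zero_mem _, fun _ _ _ _ => rfl⟩
  add_mem' hs hs' := ⟨Submodule.add_mem _ hs.1 hs'.1, fun g y hy hgy =>
    congrArg₂ (· + ·) (hs.2 g y hy hgy) (hs'.2 g y hy hgy)⟩
  smul_mem' g s hs := by
    obtain ⟨F, hF, hFd⟩ := exists_extension g
    refine ⟨fun ψ φ label k hk y hy hyV => ?_, fun a y hy hay => ?_⟩
    · refine (hs.1 ψ φ label k hk y hy hyV).smul_of_eventually (F := fun z => F (K.toFun z)) ?_
        fun z hz => ?_
      · filter_upwards [(K.preimage U).isOpen.mem_nhds hyV] with z hz using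
          (hFd _ hz).comp z (K.holomorphic z)
      · rw [hF (K.toFun z) hz.1]; rfl
    · have h1 : K.toFun (a • y) = K.toFun y := ((K.eq_iff_orbit y (a • y)).2 ⟨a, rfl⟩).symm
      have h2 : (g : U → ℂ) ⟨K.toFun (a • y), hay.1⟩ = (g : U → ℂ) ⟨K.toFun y, hy.1⟩ :=
        congrArg _ (Subtype.ext h1)
      have h3 := congrArg (fun τ => (g : U → ℂ) ⟨K.toFun y, hy.1⟩ • τ) (hs.2 a y hy hay)
      refine Eq.trans ?_ h3
      change ContinuousMultilinearMap.compContinuousLinearMap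
        ((g : U → ℂ) ⟨K.toFun (a • y), hay.1⟩ • s ⟨a • y, hay⟩) _ = _
      rw [h2]
      rfl

/-- The pullback `π^*` of tensor fields, from `U ∖ Supp D` to `π⁻¹(U) ∖ π⁻¹(Supp D)`. -/
def pullback (m : ℕ) (U : Opens X) :
    TensorField n m D.support U →ₗ[holo n U] K.Pushforward m U where
  toFun s := fun y => (s ⟨K.toFun y, y.2⟩).compContinuousLinearMap
    (fun _ => mfderiv 𝓘(ℂ, Fin n → ℂ) 𝓘(ℂ, Fin n → ℂ) K.toFun y)
  map_add' _ _ := rfl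
  map_smul' _ _ := rfl

end KawamataCover

end Pairs

end Orbifold

end

/-! Both assertions are local, and both come down to extending a coefficient, holomorphic off the
coordinate hyperplanes, across them. The tool is a Riemann extension theorem,
`exists_holomorphic_extension`, that asks for control only near points lying on exactly one
hyperplane; each estimate then concerns a single component of `D`.

Freeness: express the frame of one adapted chart in that of another
(`frame_eq_sum_transitionCoeff`). Near a general point of a component with weight c, the coefficient
has a pole of order at most ⌊m_i c⌋ from the first frame and a zero of order ⌊m'_{i'} c⌋ from the
second. Each slot where dx_i contributes some dx'_l with l ≠ i' adds a zero, because the tangential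
derivatives of a local equation of the component vanish along it. Since c ≤ 1, losing one slot
lowers the floor by at most one (`poleOrder_le`), so the zeros compensate the poles, the coefficient
is bounded (`transitionCoeff_isBigO_one`) and it extends. Membership can therefore be tested in one
chart around each point, and uniqueness of coefficients glues the local ones
(`mem_integralTensors_iff`).

Cover: in Kummer coordinates the pullback of t_h is ∏ y_i^{e_i} times a product of generators, with
e_i = k_i(m_i c_i - ⌊m_i c_i⌋), so 0 ≤ e_i < k_i (`frame_compContinuousLinearMap_eq_coframe`,
`excess_lt`). The lower bound shows that pullbacks are sections. Conversely, a coefficient of an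
invariant section, divided by this monomial, is constant on fibres, hence a function F of x. Near a
general point of {x_i = 0}, x_i F is O(|y_i|^{k_i - e_i}), so the upper bound makes F extend
(`exists_descent`). The pullback is injective because `π` is open and its differential is invertible
where no Kummer coordinate vanishes; injectivity in turn glues the local descents. -/

namespace Orbifold

/-! ### Riemann extension and vanishing estimates along coordinate hyperplanes. -/

section SeveralVariables

open Metric MeasureTheory

/-- The complement of the coordinate hyperplanes of `ℂⁿ`. -/
def torus (n : ℕ) : Set (Fin n → ℂ) := {z | ∀ i, z i ≠ 0}

theorem isOpen_torus (n : ℕ) : IsOpen (torus n) := by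
  have : torus n = ⋂ i, {z | z i ≠ 0} := by ext; simp [torus]
  rw [this]
  exact isOpen_iInter_of_finite fun i => isOpen_ne_fun (continuous_apply i) continuous_const

theorem dense_linear_ne_zero {E : Type*} [NormedAddCommGroup E] [NormedSpace ℂ E] {l : E →L[ℂ] ℂ}
    (hl : l ≠ 0) : Dense {z | l z ≠ 0} := by
  have h : {z | l z ≠ 0} = (LinearMap.ker (l : E →ₗ[ℂ] ℂ) : Set E)ᶜ := by ext; simp
  rw [h, ← interior_eq_empty_iff_dense_compl]
  by_contra hne
  have := Submodule.eq_top_of_nonempty_interior' _ (Set.nonempty_iff_ne_empty.2 hne)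
  exact hl (by ext z; exact LinearMap.mem_ker.1 (this ▸ Submodule.mem_top : z ∈ _))

theorem isOpen_linear_ne_zero {E : Type*} [NormedAddCommGroup E] [NormedSpace ℂ E]
    (l : E →L[ℂ] ℂ) : IsOpen {z | l z ≠ 0} :=
  isOpen_ne_fun l.continuous continuous_const

/-- A finite intersection of complements of hyperplanes. Distinct coordinates are wanted because the
diagonal line through such a point meets the coordinate hyperplanes one at a time. -/
theorem dense_torus_injective (n : ℕ) :
    Dense {z : Fin n → ℂ | z ∈ torus n ∧ Function.Injective z} := by
  let pr : Fin n → ((Fin n → ℂ) →L[ℂ] ℂ) := fun i => ContinuousLinearMap.proj i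
  have h1 : Dense (⋂ i, {z | pr i z ≠ 0}) :=
    dense_iInter_of_isOpen (fun i => isOpen_linear_ne_zero _) fun i => dense_linear_ne_zero fun h =>
      one_ne_zero (congrArg (fun l => l (fun _ => (1 : ℂ))) h : (1 : ℂ) = 0)
  have h2 : Dense (⋂ ij : {ij : Fin n × Fin n // ij.1 ≠ ij.2},
      {z | (pr ij.1.1 - pr ij.1.2) z ≠ 0}) := by
    refine dense_iInter_of_isOpen (fun i => isOpen_linear_ne_zero _) fun ij =>
      dense_linear_ne_zero fun h => ?_
    have := congrArg (fun l => l (Pi.single ij.1.1 (1 : ℂ))) h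
    simp [pr, ij.2] at this
  refine (h1.inter_of_isOpen_right h2 (isOpen_iInter_of_finite fun i =>
    isOpen_linear_ne_zero _)).mono ?_
  rintro z ⟨hz1, hz2⟩
  simp only [Set.mem_iInter, Set.mem_ofPred_eq] at hz1 hz2
  refine ⟨hz1, fun i j hij => ?_⟩
  by_contra hne
  exact hz2 ⟨(i, j), hne⟩ (by simp [pr, hij])

theorem dense_torus (n : ℕ) : Dense (torus n) := (dense_torus_injective n).mono fun _ h => h.1

theorem eqOn_of_dense {E : Type*} [TopologicalSpace E] {S O : Set E} {f g : E → ℂ} (hS : Dense S)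
    (hO : IsOpen O) (hf : ContinuousOn f O) (hg : ContinuousOn g O)
    (h : ∀ z ∈ O, z ∈ S → f z = g z) : Set.EqOn f g O :=
  Set.EqOn.of_subset_closure (s := O ∩ S) (fun z hz => h z hz.1 hz.2) hf hg Set.inter_subset_left
    (hS.open_subset_closure_inter hO)

/-- Differentiation under the integral sign; the domination comes from Cauchy's estimate on a
thickening of the compact circle. -/
theorem differentiableAt_circleIntegral {n : ℕ} {f : (Fin n → ℂ) → ℂ} {O : Set (Fin n → ℂ)}
    (hO : IsOpen O) (hf : DifferentiableOn ℂ f O) (v p : Fin n → ℂ) {r : ℝ} (hr : 0 < r)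
    (h : ∀ w ∈ sphere (0 : ℂ) r, p + w • v ∈ O) :
    DifferentiableAt ℂ (fun z => ∮ w in C(0, r), w⁻¹ * f (z + w • v)) p := by
  have hK : IsCompact ((fun w : ℂ => p + w • v) '' sphere 0 r) :=
    (isCompact_sphere 0 r).image (by fun_prop)
  obtain ⟨ε, hε, hεO⟩ := hK.exists_cthickening_subset_open hO (by rintro _ ⟨w, hw, rfl⟩; exact h w hw)
  set K := (fun w : ℂ => p + w • v) '' sphere 0 r
  have hmemK : ∀ θ, p + circleMap 0 r θ • v ∈ K := fun θ =>
    ⟨_, circleMap_mem_sphere 0 hr.le θ, rfl⟩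
  have hcK : IsCompact (cthickening ε K) := hK.cthickening
  obtain ⟨C, hC⟩ := hcK.exists_bound_of_continuousOn (hf.continuousOn.mono hεO)
  -- One half of `ε` pays for moving `z` away from `p`, the other for the ball on which Cauchy's
  -- estimate is applied.
  have hsub : ∀ z ∈ ball p (ε / 2), ∀ θ, ball (z + circleMap 0 r θ • v) (ε / 2) ⊆ cthickening ε K := by
    intro z hz θ u hu
    refine mem_cthickening_of_dist_le u _ ε K (hmemK θ) ?_
    have h1 : dist (z + circleMap 0 r θ • v) (p + circleMap 0 r θ • v) < ε / 2 := by
      simpa using hz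
    have := dist_triangle u (z + circleMap 0 r θ • v) (p + circleMap 0 r θ • v)
    have h2 : dist u (z + circleMap 0 r θ • v) < ε / 2 := hu
    linarith
  have hmemO : ∀ z ∈ ball p (ε / 2), ∀ θ, z + circleMap 0 r θ • v ∈ O := fun z hz θ =>
    hεO (hsub z hz θ (mem_ball_self (by positivity)))
  have hbound : ∀ z ∈ ball p (ε / 2), ∀ θ,
      ‖fderiv ℂ f (z + circleMap 0 r θ • v)‖ ≤ (2 * C) / (ε / 2) := by
    intro z hz θ
    refine Complex.norm_fderiv_le_div_of_mapsTo_ball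
      (hf.mono ((hsub z hz θ).trans hεO)) (fun u hu => ?_) (by positivity)
    rw [mem_closedBall, dist_eq_norm]
    refine (norm_sub_le _ _).trans ?_
    have h1 := hC u (hsub z hz θ hu)
    have h2 := hC _ (hsub z hz θ (mem_ball_self (by positivity)))
    linarith
  -- On the circle dw / w = i dθ, so the kernel is constant and only `f` has to be differentiated.
  let c : ℝ → ℂ := fun θ => deriv (circleMap 0 r) θ * (circleMap 0 r θ)⁻¹
  have hcI : ∀ θ, c θ = Complex.I := fun θ => by
    have : circleMap 0 r θ ≠ 0 := circleMap_ne_center hr.ne'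
    simp only [c, deriv_circleMap]
    field_simp
  have hcont : ∀ z ∈ ball p (ε / 2), Continuous fun θ => f (z + circleMap 0 r θ • v) := fun z hz =>
    hf.continuousOn.comp_continuous (by fun_prop) (hmemO z hz)
  have key : HasFDerivAt
      (fun z => ∫ θ in (0 : ℝ)..2 * Real.pi, Complex.I • f (z + circleMap 0 r θ • v))
      (∫ θ in (0 : ℝ)..2 * Real.pi, Complex.I • fderiv ℂ f (p + circleMap 0 r θ • v)) p := by
    refine intervalIntegral.hasFDerivAt_integral_of_dominated_of_fderiv_le
      (F' := fun z θ => Complex.I • fderiv ℂ f (z + circleMap 0 r θ • v))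
      (bound := fun _ => (2 * C) / (ε / 2))
      (ball_mem_nhds p (half_pos hε)) ?_ ?_ ?_ ?_ ?_ ?_
    · filter_upwards [ball_mem_nhds p (half_pos hε)] with z hz
      exact ((hcont z hz).const_smul Complex.I).aestronglyMeasurable
    · exact ((hcont p (mem_ball_self (half_pos hε))).const_smul Complex.I).intervalIntegrable _ _
    · have h1 : Measurable fun θ => fderiv ℂ f (p + circleMap 0 r θ • v) :=
        (measurable_fderiv ℂ f).comp
          (Continuous.measurable (by fun_prop))
      exact (h1.stronglyMeasurable.const_smul Complex.I).aestronglyMeasurable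
    · refine Eventually.of_forall fun θ _ z hz => ?_
      rw [norm_smul, Complex.norm_I, one_mul]
      exact hbound z hz θ
    · exact intervalIntegrable_const
    · refine Eventually.of_forall fun θ _ z hz => ?_
      have h1 : HasFDerivAt f (fderiv ℂ f (z + circleMap 0 r θ • v)) (z + circleMap 0 r θ • v) :=
        (hf.differentiableAt (hO.mem_nhds (hmemO z hz θ))).hasFDerivAt
      exact ((hasFDerivAt_comp_add_right (circleMap 0 r θ • v)).2 h1).const_smul Complex.I
  refine key.differentiableAt.congr_of_eventuallyEq (Eventually.of_forall fun z => ?_)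
  simp only [circleIntegral]
  refine intervalIntegral.integral_congr fun θ _ => ?_
  change _ = Complex.I * _
  rw [← hcI θ]
  simp only [c, smul_eq_mul, mul_assoc]

theorem circleIntegral_of_removable {q : ℂ → ℂ} {r : ℝ} (hr : 0 < r)
    (hd : ∀ w ∈ closedBall (0 : ℂ) r, ∀ᶠ u in 𝓝[≠] w, DifferentiableAt ℂ q u)
    (hlim : ∀ w ∈ closedBall (0 : ℂ) r, Tendsto (fun u => (u - w) * q u) (𝓝[≠] w) (𝓝 0))
    (h0 : DifferentiableAt ℂ q 0) (hs : ∀ w ∈ sphere (0 : ℂ) r, DifferentiableAt ℂ q w) :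
    (∮ w in C(0, r), w⁻¹ * q w) = 2 * Real.pi * Complex.I * q 0 := by
  -- `Q` fills every removable singularity with its limit. It equals `q` wherever `q` is
  -- differentiable, in particular on the circle and at the centre, so Cauchy's formula for `Q`
  -- gives the one for `q`.
  let Q : ℂ → ℂ := fun w => limUnder (𝓝[≠] w) q
  have hQ : ∀ w, DifferentiableAt ℂ q w → Q w = q w := fun w hw =>
    (hw.continuousAt.tendsto.mono_left nhdsWithin_le_nhds).limUnder_eq
  have hQd : ∀ w ∈ closedBall (0 : ℂ) r, DifferentiableAt ℂ Q w := by
    intro w hw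
    have ho : (fun z => q z - q w) =o[𝓝[≠] w] fun z => (z - w)⁻¹ := by
      have h1 : q =o[𝓝[≠] w] fun z => (z - w)⁻¹ := by
        rw [Asymptotics.isLittleO_iff_tendsto']
        · refine (hlim w hw).congr fun u => ?_
          rw [div_inv_eq_mul, mul_comm]
        · filter_upwards [self_mem_nhdsWithin] with u hu h
          exact absurd (sub_eq_zero.1 (inv_eq_zero.1 h)) hu
      refine h1.sub ?_
      rw [Asymptotics.isLittleO_iff_tendsto']
      · have : Tendsto (fun u => q w * (u - w)) (𝓝[≠] w) (𝓝 (q w * (w - w))) :=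
          (Continuous.tendsto (by fun_prop) w).mono_left nhdsWithin_le_nhds
        rw [sub_self, mul_zero] at this
        exact this.congr fun u => by rw [div_inv_eq_mul]
      · filter_upwards [self_mem_nhdsWithin] with u hu h
        exact absurd (sub_eq_zero.1 (inv_eq_zero.1 h)) hu
    have h2 := Complex.differentiableOn_update_limUnder_insert_of_isLittleO
      (s := {u | DifferentiableAt ℂ q u}) (hd w hw)
      (fun u hu => DifferentiableAt.differentiableWithinAt hu) ho
    refine (h2.differentiableAt (insert_mem_nhds_iff.2 (hd w hw))).congr_of_eventuallyEq ?_
    have h3 := hd w hw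
    rw [eventually_nhdsWithin_iff] at h3
    filter_upwards [h3] with u hu
    by_cases huw : u = w
    · subst huw; simp [Q]
    · rw [Function.update_of_ne huw, hQ u (hu huw)]
  have h1 : (∮ w in C(0, r), w⁻¹ * q w) = ∮ w in C(0, r), (w - 0)⁻¹ • Q w :=
    circleIntegral.integral_congr hr.le fun w hw => by
      simp only [sub_zero, smul_eq_mul, hQ w (hs w hw)]
  rw [h1, DifferentiableOn.circleIntegral_sub_inv_smul
    (fun w hw => (hQd w hw).differentiableWithinAt) (mem_ball_self hr), hQ 0 h0]
  simp [smul_eq_mul]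

/-- Riemann's extension theorem along the coordinate hyperplanes of `ℂⁿ`: it is enough to control
the function near the points which lie on one hyperplane only. -/
theorem exists_holomorphic_extension {n : ℕ} (p : Fin n → ℂ) (f : (Fin n → ℂ) → ℂ)
    (hf : ∀ᶠ z in 𝓝 p, z ∈ torus n → DifferentiableAt ℂ f z)
    (hlim : ∀ᶠ q in 𝓝 p, ∀ i, q i = 0 → (∀ j, j ≠ i → q j ≠ 0) →
      Tendsto (fun z => z i * f z) (𝓝[torus n] q) (𝓝 0)) :
    ∃ g : (Fin n → ℂ) → ℂ, ∀ᶠ z in 𝓝 p, DifferentiableAt ℂ g z ∧ (z ∈ torus n → g z = f z) := by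
  have hp : ∀ᶠ z in 𝓝 p, ∀ i, p i ≠ 0 → z i ≠ 0 := by
    rw [eventually_all]
    intro i
    by_cases hi : p i = 0
    · simp [hi]
    · filter_upwards [(continuous_apply i).continuousAt.eventually_ne hi] with z hz _ using hz
  obtain ⟨ε, hε, hball⟩ := Metric.eventually_nhds_iff_ball.1 (hf.and (hlim.and hp))
  -- Two displacements of size `r`, of `z` from `p` and along the disc, must stay within `ε`.
  set r := ε / 3 with hr
  have hr0 : 0 < r := by positivity
  -- The Cauchy integral is taken along the diagonal: moving by `w • e` changes all coordinates at
  -- once, so a single circle avoids all the hyperplanes.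
  let e : Fin n → ℂ := fun _ => 1
  have hmem : ∀ z ∈ ball p r, ∀ w ∈ closedBall (0 : ℂ) r, z + w • e ∈ ball p ε := by
    intro z hz w hw
    rw [mem_ball, dist_eq_norm] at hz ⊢
    rw [mem_closedBall, dist_zero_right] at hw
    have h1 : ‖w • e‖ ≤ ‖w‖ := (pi_norm_le_iff_of_nonneg (norm_nonneg w)).2 fun i => by simp [e]
    calc ‖z + w • e - p‖ = ‖(z - p) + w • e‖ := by congr 1; abel
      _ ≤ ‖z - p‖ + ‖w • e‖ := norm_add_le _ _
      _ < ε := by linarith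
  set O := ball p ε ∩ torus n
  have hO : IsOpen O := isOpen_ball.inter (isOpen_torus n)
  have hfO : DifferentiableOn ℂ f O := fun z hz =>
    ((hball z hz.1).1 hz.2).differentiableWithinAt
  have hsphere : ∀ z ∈ ball p r, ∀ w ∈ sphere (0 : ℂ) r, z + w • e ∈ O := by
    intro z hz w hw
    have h1 := hmem z hz w (sphere_subset_closedBall hw)
    -- If p_i = 0 then |z_i| < r = |w|, so z_i + w ≠ 0. Otherwise the i-th coordinate vanishes
    -- nowhere on the large ball.
    refine ⟨h1, fun i => ?_⟩
    by_cases hi : p i = 0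
    · intro h0
      have h2 : z i + w = 0 := by simpa [e] using h0
      have h3 : ‖z i‖ < r := by
        have := (norm_le_pi_norm (z - p) i).trans_lt (mem_ball_iff_norm.1 hz)
        simpa [hi] using this
      rw [eq_neg_of_add_eq_zero_left h2, norm_neg, mem_sphere_zero_iff_norm.1 hw] at h3
      exact lt_irrefl _ h3
    · exact (hball _ h1).2.2 i hi
  let g : (Fin n → ℂ) → ℂ := fun z =>
    (2 * Real.pi * Complex.I)⁻¹ * ∮ w in C(0, r), w⁻¹ * f (z + w • e)
  have hg : ∀ z ∈ ball p r, DifferentiableAt ℂ g z := fun z hz =>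
    (differentiableAt_circleIntegral hO hfO e z hr0 (hsphere z hz)).const_mul _
  have hcauchy : ∀ z ∈ ball p r ∩ torus n, z ∈ {z | z ∈ torus n ∧ Function.Injective z} →
      g z = f z := by
    rintro z ⟨hz, hzt⟩ ⟨-, hinj⟩
    have hzO : z ∈ O := ⟨by simpa using hmem z hz 0 (mem_closedBall_self hr0.le), hzt⟩
    have hdiff : ∀ w, z + w • e ∈ O → DifferentiableAt ℂ (fun w : ℂ => f (z + w • e)) w :=
      fun w hw => DifferentiableAt.fun_comp' w (hfO.differentiableAt (hO.mem_nhds hw)) (by fun_prop)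
    have hcont : Continuous fun w : ℂ => z + w • e := by fun_prop
    have hpunct : ∀ w ∈ closedBall (0 : ℂ) r, ∀ᶠ u in 𝓝[≠] w, z + u • e ∈ O := by
      intro w hw
      have h1 : ∀ᶠ u in 𝓝[≠] w, z + u • e ∈ ball p ε :=
        ((hcont.tendsto w).eventually (isOpen_ball.mem_nhds (hmem z hz w hw))).filter_mono
          nhdsWithin_le_nhds
      have h2 : ∀ᶠ u in 𝓝[≠] w, ∀ i, z i + u ≠ 0 := by
        rw [eventually_all]
        intro i
        by_cases hi : z i + w = 0
        · filter_upwards [self_mem_nhdsWithin] with u hu h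
          exact hu (add_left_cancel (h.trans hi.symm))
        · exact (ContinuousAt.eventually_ne (g := fun u => z i + u) (by fun_prop) hi).filter_mono
            nhdsWithin_le_nhds
      filter_upwards [h1, h2] with u hu1 hu2
      exact ⟨hu1, fun i => by simpa [e] using hu2 i⟩
    have := circleIntegral_of_removable (q := fun w => f (z + w • e)) hr0
      (fun w hw => (hpunct w hw).mono hdiff) (fun w hw => ?_)
      (hdiff 0 (by simpa using hzO)) (fun w hw => hdiff w (hsphere z hz w hw))
    · have hpi : (2 * Real.pi * Complex.I : ℂ) ≠ 0 := Complex.two_pi_I_ne_zero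
      simp only [g, this, zero_smul, add_zero]
      field_simp
    -- Since the coordinates of `z` are distinct, at most one coordinate of z + w e vanishes, which
    -- is where the one-hyperplane hypothesis applies; that coordinate of z + u e is u - w.
    · by_cases hzero : ∃ i, z i + w = 0
      · obtain ⟨i, hi⟩ := hzero
        have h1 := (hball _ (hmem z hz w hw)).2.1 i (by simpa [e] using hi) (fun j hj h => hj (by
          have h' : z j + w = 0 := by simpa [e] using h
          exact hinj (add_right_cancel (h'.trans hi.symm))))
        have h2 : Tendsto (fun u : ℂ => z + u • e) (𝓝[≠] w) (𝓝[torus n] (z + w • e)) :=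
          tendsto_nhdsWithin_iff.2 ⟨(hcont.tendsto w).mono_left nhdsWithin_le_nhds,
            (hpunct w hw).mono fun u hu => hu.2⟩
        refine (h1.comp h2).congr fun u => ?_
        have h3 : (z + u • e) i = u - w := by
          simp only [e, Pi.add_apply, Pi.smul_apply, smul_eq_mul, mul_one]
          linear_combination hi
        simp only [Function.comp_apply, h3]
      · have hwO : z + w • e ∈ O :=
          ⟨hmem z hz w hw, fun i h => hzero ⟨i, by simpa [e] using h⟩⟩
        have h1 : ContinuousAt (fun u => (u - w) * f (z + u • e)) w :=
          ContinuousAt.mul (by fun_prop) (hdiff w hwO).continuousAt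
        have h2 := h1.tendsto.mono_left (nhdsWithin_le_nhds (s := {w}ᶜ))
        simpa using h2
  have heq : Set.EqOn g f (ball p r ∩ torus n) :=
    eqOn_of_dense (dense_torus_injective n) (isOpen_ball.inter (isOpen_torus n))
      (fun z hz => (hg z hz.1).continuousAt.continuousWithinAt)
      (hfO.continuousOn.mono (Set.inter_subset_inter_left _
        (ball_subset_ball (by rw [hr]; linarith)))) hcauchy
  exact ⟨g, by filter_upwards [ball_mem_nhds p hr0] with z hz using ⟨hg z hz, fun h => heq ⟨hz, h⟩⟩⟩

/-- A C¹ function is locally Lipschitz: compare its value at z with its value, zero, at the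
projection of z to the hyperplane, which is at distance |z_i|. -/
theorem isBigO_coord_of_vanishing {n : ℕ} {f : (Fin n → ℂ) → ℂ} {q : Fin n → ℂ} {i : Fin n}
    (hf : ContDiffAt ℂ 1 f q) (hq : q i = 0) (h : ∀ᶠ z in 𝓝 q, z i = 0 → f z = 0) :
    f =O[𝓝 q] fun z => z i := by
  obtain ⟨K, t, ht, hK⟩ := hf.exists_lipschitzOnWith
  have hupd : Tendsto (fun z : Fin n → ℂ => Function.update z i 0) (𝓝 q) (𝓝 q) := by
    have h1 : Continuous fun z : Fin n → ℂ => Function.update z i (0 : ℂ) :=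
      continuous_id.update i continuous_const
    have h2 := h1.tendsto q
    have h3 : Function.update q i 0 = q := by rw [← hq, Function.update_eq_self]
    rwa [h3] at h2
  refine Asymptotics.IsBigO.of_bound K ?_
  filter_upwards [ht, hupd.eventually ht, hupd.eventually h] with z hz hz' h0
  have h1 := hK.dist_le_mul z hz _ hz'
  rw [h0 (by simp), dist_zero_right] at h1
  refine h1.trans (mul_le_mul_of_nonneg_left ?_ K.2)
  rw [dist_pi_le_iff (norm_nonneg _)]
  intro j
  by_cases hj : j = i
  · subst hj; simp
  · simp [hj]

end SeveralVariables

/-- Density of the torus, transported by the chart. It lets every later identity be checked off all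
coordinate hyperplanes, whether or not they belong to the divisor. -/
theorem eventuallyEq_of_torus {n : ℕ} {M : Type*} [TopologicalSpace M]
    (φ : OpenPartialHomeomorph M (Fin n → ℂ)) {x : M}
    (hx : x ∈ φ.source) {f g : M → ℂ}
    (hf : ∀ᶠ z in 𝓝 x, ContinuousAt f z) (hg : ∀ᶠ z in 𝓝 x, ContinuousAt g z)
    (h : ∀ᶠ z in 𝓝 x, φ z ∈ torus n → f z = g z) : ∀ᶠ z in 𝓝 x, f z = g z := by
  obtain ⟨V, hV, hVo, hxV⟩ := eventually_nhds_iff.1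
    (hf.and (hg.and (h.and (φ.open_source.eventually_mem hx))))
  have hVs : V ⊆ φ.source := fun z hz => (hV z hz).2.2.2
  have hcont : ∀ f : M → ℂ, (∀ z ∈ V, ContinuousAt f z) →
      ContinuousOn (fun w => f (φ.symm w)) (φ '' V) := by
    rintro f hf _ ⟨z, hz, rfl⟩
    refine (ContinuousAt.comp (f := φ.symm) (g := f) ?_
      (φ.continuousAt_symm (φ.map_source (hVs hz)))).continuousWithinAt
    rw [φ.left_inv (hVs hz)]
    exact hf z hz
  have heq := eqOn_of_dense (dense_torus n) (φ.isOpen_image_of_subset_source hVo hVs)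
    (hcont f fun z hz => (hV z hz).1) (hcont g fun z hz => (hV z hz).2.1) (by
      rintro _ ⟨z, hz, rfl⟩ ht
      simpa [φ.left_inv (hVs hz)] using (hV z hz).2.2.1 ht)
  filter_upwards [hVo.mem_nhds hxV] with z hz
  simpa [φ.left_inv (hVs hz)] using heq ⟨z, hz, rfl⟩

/-! ### Cotangent vectors, tensors and charts. -/

section Tensors

variable {n m : ℕ} {M : Type*} [TopologicalSpace M] [ChartedSpace (Fin n → ℂ) M]

theorem tensorOf_apply {x : M} (α : Fin m → (TangentSpace 𝓘(ℂ, Fin n → ℂ) x →L[ℂ] ℂ))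
    (v : Fin m → TangentSpace 𝓘(ℂ, Fin n → ℂ) x) : tensorOf α v = ∏ k, α k (v k) := by
  simp [tensorOf]

theorem tensorOf_smul {x : M} (c : Fin m → ℂ)
    (α : Fin m → (TangentSpace 𝓘(ℂ, Fin n → ℂ) x →L[ℂ] ℂ)) :
    tensorOf (fun k => c k • α k) = (∏ k, c k) • tensorOf α := by
  ext v
  simp [tensorOf_apply, Finset.prod_mul_distrib]

theorem tensorOf_sum {x : M} {ι : Type*} [Fintype ι] (A : Fin m → ι → ℂ)
    (β : ι → (TangentSpace 𝓘(ℂ, Fin n → ℂ) x →L[ℂ] ℂ)) :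
    tensorOf (fun k => ∑ j, A k j • β j) =
      ∑ h : Fin m → ι, (∏ k, A k (h k)) • tensorOf fun k => β (h k) := by
  classical
  ext v
  rw [tensorOf_apply]
  simp only [sum_apply, smul_apply, tensorOf_apply,
    Finset.prod_univ_sum, Fintype.piFinset_univ, smul_eq_mul, Finset.prod_mul_distrib]

theorem tensorOf_comp {M' : Type*} [TopologicalSpace M'] [ChartedSpace (Fin n → ℂ) M'] {x : M}
    {y : M'} (α : Fin m → (TangentSpace 𝓘(ℂ, Fin n → ℂ) x →L[ℂ] ℂ))
    (L : TangentSpace 𝓘(ℂ, Fin n → ℂ) y →L[ℂ] TangentSpace 𝓘(ℂ, Fin n → ℂ) x) :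
    (tensorOf α).compContinuousLinearMap (fun _ => L) = tensorOf fun k => (α k).comp L := by
  ext v
  simp [tensorOf_apply]

theorem sum_smul_compContinuousLinearMap {M' : Type*} [TopologicalSpace M']
    [ChartedSpace (Fin n → ℂ) M'] {x : M} {y : M'} {ι : Type*} [Fintype ι] (c : ι → ℂ)
    (t : ι → CoTensor n m x)
    (L : TangentSpace 𝓘(ℂ, Fin n → ℂ) y →L[ℂ] TangentSpace 𝓘(ℂ, Fin n → ℂ) x) :
    (∑ h, c h • t h).compContinuousLinearMap (fun _ => L) =
      ∑ h, c h • (t h).compContinuousLinearMap (fun _ => L) := by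
  ext v
  simp

section Chart

variable {φ : OpenPartialHomeomorph M (Fin n → ℂ)}

theorem mdifferentiableAt_chart (hφ : φ ∈ IsManifold.maximalAtlas 𝓘(ℂ, Fin n → ℂ) ω M) {x : M}
    (hx : x ∈ φ.source) : MDifferentiableAt 𝓘(ℂ, Fin n → ℂ) 𝓘(ℂ, Fin n → ℂ) φ x :=
  (contMDiffAt_of_mem_maximalAtlas hφ hx).mdifferentiableAt (by simp)

theorem mdifferentiableAt_chart_symm (hφ : φ ∈ IsManifold.maximalAtlas 𝓘(ℂ, Fin n → ℂ) ω M)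
    {z : Fin n → ℂ} (hz : z ∈ φ.target) :
    MDifferentiableAt 𝓘(ℂ, Fin n → ℂ) 𝓘(ℂ, Fin n → ℂ) φ.symm z :=
  (contMDiffAt_symm_of_mem_maximalAtlas hφ hz).mdifferentiableAt (by simp)

theorem mdifferentiableAt_comp_chart (hφ : φ ∈ IsManifold.maximalAtlas 𝓘(ℂ, Fin n → ℂ) ω M)
    {x : M} (hx : x ∈ φ.source) {F : (Fin n → ℂ) → ℂ} (hF : DifferentiableAt ℂ F (φ x)) :
    MDifferentiableAt 𝓘(ℂ, Fin n → ℂ) 𝓘(ℂ, ℂ) (fun z => F (φ z)) x :=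
  hF.mdifferentiableAt.comp x (mdifferentiableAt_chart hφ hx)

theorem differentiableAt_comp_chart_symm
    (hφ : φ ∈ IsManifold.maximalAtlas 𝓘(ℂ, Fin n → ℂ) ω M) {z : Fin n → ℂ} (hz : z ∈ φ.target)
    {f : M → ℂ} (hf : MDifferentiableAt 𝓘(ℂ, Fin n → ℂ) 𝓘(ℂ, ℂ) f (φ.symm z)) :
    DifferentiableAt ℂ (fun w => f (φ.symm w)) z :=
  (hf.comp z (mdifferentiableAt_chart_symm hφ hz)).differentiableAt

theorem mdifferentiableAt_coord (hφ : φ ∈ IsManifold.maximalAtlas 𝓘(ℂ, Fin n → ℂ) ω M)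
    {x : M} (hx : x ∈ φ.source) (i : Fin n) :
    MDifferentiableAt 𝓘(ℂ, Fin n → ℂ) 𝓘(ℂ, ℂ) (fun z => φ z i) x :=
  mdifferentiableAt_comp_chart (F := fun w => w i) hφ hx (differentiableAt_apply i _)

/-- The differential of a function, as a cotangent vector. -/
noncomputable def differential (f : M → ℂ) (x : M) : TangentSpace 𝓘(ℂ, Fin n → ℂ) x →L[ℂ] ℂ :=
  mfderiv 𝓘(ℂ, Fin n → ℂ) 𝓘(ℂ, ℂ) f x

theorem dcoord_eq_differential (φ : OpenPartialHomeomorph M (Fin n → ℂ)) (i : Fin n) (x : M) :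
    dcoord φ i x = differential (fun z => φ z i) x := rfl

theorem differential_congr {f g : M → ℂ} {x : M} (h : f =ᶠ[𝓝 x] g) :
    differential (n := n) f x = differential g x :=
  h.mfderiv_eq

theorem differential_comp_chart (hφ : φ ∈ IsManifold.maximalAtlas 𝓘(ℂ, Fin n → ℂ) ω M)
    {x : M} (hx : x ∈ φ.source) {F : (Fin n → ℂ) → ℂ} (hF : DifferentiableAt ℂ F (φ x))
    (v : TangentSpace 𝓘(ℂ, Fin n → ℂ) x) :
    differential (fun z => F (φ z)) x v =
      fderiv ℂ F (φ x) (mfderiv 𝓘(ℂ, Fin n → ℂ) 𝓘(ℂ, Fin n → ℂ) φ x v) := by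
  have h := mfderiv_comp x hF.mdifferentiableAt (mdifferentiableAt_chart hφ hx)
  rw [mfderiv_eq_fderiv] at h
  exact congrArg (fun L => L v) h

theorem dcoord_apply (hφ : φ ∈ IsManifold.maximalAtlas 𝓘(ℂ, Fin n → ℂ) ω M)
    {x : M} (hx : x ∈ φ.source) (i : Fin n) (v : TangentSpace 𝓘(ℂ, Fin n → ℂ) x) :
    dcoord φ i x v =
      (mfderiv 𝓘(ℂ, Fin n → ℂ) 𝓘(ℂ, Fin n → ℂ) φ x v : Fin n → ℂ) i := by
  rw [dcoord_eq_differential, differential_comp_chart (F := fun w => w i) hφ hx (differentiableAt_apply i _)]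
  rw [(hasFDerivAt_apply (𝕜 := ℂ) i (φ x)).fderiv]
  rfl

theorem differential_comp_chart_eq_sum (hφ : φ ∈ IsManifold.maximalAtlas 𝓘(ℂ, Fin n → ℂ) ω M)
    {x : M} (hx : x ∈ φ.source) {F : (Fin n → ℂ) → ℂ} (hF : DifferentiableAt ℂ F (φ x)) :
    differential (fun z => F (φ z)) x =
      ∑ j, (fderiv ℂ F (φ x) (Pi.single j 1)) • dcoord φ j x := by
  ext v
  rw [differential_comp_chart hφ hx hF]
  set w : Fin n → ℂ := mfderiv 𝓘(ℂ, Fin n → ℂ) 𝓘(ℂ, Fin n → ℂ) φ x v with hw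
  have h1 : w = ∑ j, w j • (Pi.single j (1 : ℂ) : Fin n → ℂ) := by
    ext i; simp [Finset.sum_apply, Pi.single_apply]
  have h2 : fderiv ℂ F (φ x) w = ∑ j, w j * fderiv ℂ F (φ x) (Pi.single j 1) := by
    conv_lhs => rw [h1]
    simp
  refine h2.trans ?_
  rw [sum_apply]
  refine Finset.sum_congr rfl fun j _ => ?_
  rw [smul_apply, dcoord_apply hφ hx, smul_eq_mul, mul_comm]

theorem exists_dual_dcoord [IsManifold 𝓘(ℂ, Fin n → ℂ) ω M]
    (hφ : φ ∈ IsManifold.maximalAtlas 𝓘(ℂ, Fin n → ℂ) ω M) {x : M} (hx : x ∈ φ.source) :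
    ∃ e : Fin n → TangentSpace 𝓘(ℂ, Fin n → ℂ) x,
      ∀ i j, dcoord φ i x (e j) = if i = j then 1 else 0 := by
  have : IsManifold 𝓘(ℂ, Fin n → ℂ) 1 M := IsManifold.of_le (n := ω) (by simp)
  have hd : φ.MDifferentiable 𝓘(ℂ, Fin n → ℂ) 𝓘(ℂ, Fin n → ℂ) :=
    ⟨fun z hz => (mdifferentiableAt_chart hφ hz).mdifferentiableWithinAt,
      fun z hz => (mdifferentiableAt_chart_symm hφ hz).mdifferentiableWithinAt⟩
  choose e he using fun j : Fin n => hd.mfderiv_surjective hx (Pi.single j (1 : ℂ) : Fin n → ℂ)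
  refine ⟨e, fun i j => ?_⟩
  rw [dcoord_apply hφ hx, he j]
  exact Pi.single_apply j (1 : ℂ) i

/-- Evaluating on tuples of vectors dual to the dx_i isolates one coefficient. -/
theorem eq_zero_of_sum_smul_tensorOf_dcoord [IsManifold 𝓘(ℂ, Fin n → ℂ) ω M]
    (hφ : φ ∈ IsManifold.maximalAtlas 𝓘(ℂ, Fin n → ℂ) ω M) {x : M} (hx : x ∈ φ.source)
    {c : (Fin m → Fin n) → ℂ} (h : ∑ h, c h • tensorOf (fun k => dcoord φ (h k) x) = 0)
    (a : Fin m → Fin n) : c a = 0 := by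
  classical
  obtain ⟨e, he⟩ := exists_dual_dcoord hφ hx
  have h1 := congrArg (fun t => t fun k => e (a k)) h
  simp only [sum_apply, smul_apply,
    tensorOf_apply, he, zero_apply, smul_eq_mul] at h1
  rw [Finset.sum_eq_single a] at h1
  · simpa using h1
  · intro b _ hb
    obtain ⟨k, hk⟩ := Function.ne_iff.1 hb
    rw [Finset.prod_eq_zero (Finset.mem_univ k) (if_neg hk), mul_zero]
  · simp

end Chart

theorem LocallyGenerated.congr {Z : Set M} {U U' : Opens M} {ι : Type} [Fintype ι]
    {t : ι → (x : M) → CoTensor n m x} {s : TensorField n m Z U} {s' : TensorField n m Z U'} {p : M}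
    (hs : LocallyGenerated t s p) (h : ∀ᶠ x in 𝓝 p, ∀ (hx' : x ∈ U' ∧ x ∉ Z),
      ∃ hx : x ∈ U ∧ x ∉ Z, s' ⟨x, hx'⟩ = s ⟨x, hx⟩) : LocallyGenerated t s' p := by
  obtain ⟨f, hf⟩ := hs
  refine ⟨f, ?_⟩
  filter_upwards [hf, h] with x hx hx'
  refine ⟨hx.1, fun hxU => ?_⟩
  obtain ⟨h1, h2⟩ := hx' hxU
  rw [h2, hx.2 h1]

end Tensors

/-! ### Pole orders and pointwise independence of the frame. -/

section Divisor

variable {n m : ℕ} {X : Type*} [TopologicalSpace X] [ChartedSpace (Fin n → ℂ) X]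
  (D : SmoothOrbifoldDivisor n X) {φ : OpenPartialHomeomorph X (Fin n → ℂ)}
  {label : Fin n → Option (Fin D.numComp)}

namespace SmoothOrbifoldDivisor

variable {D}

theorem IsAdapted.mem_comp_iff (hφ : D.IsAdapted φ label) {x : X} (hx : x ∈ φ.source)
    {i : Fin n} {j : Fin D.numComp} (hij : label i = some j) : x ∈ D.comp j ↔ φ x i = 0 := by
  have h := Set.ext_iff.1 (hφ.hyperplane i j hij) x
  simpa [hx] using h

theorem IsAdapted.mem_support_iff (hφ : D.IsAdapted φ label) {x : X} (hx : x ∈ φ.source) :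
    x ∈ D.support ↔ ∃ i j, label i = some j ∧ φ x i = 0 := by
  constructor
  · intro h
    obtain ⟨j, hj⟩ := Set.mem_iUnion.1 h
    obtain ⟨i, hi⟩ := hφ.label_surj j ⟨x, hx, hj⟩
    exact ⟨i, j, hi, (IsAdapted.mem_comp_iff hφ hx hi).1 hj⟩
  · rintro ⟨i, j, hij, h0⟩
    exact Set.mem_iUnion.2 ⟨j, (IsAdapted.mem_comp_iff hφ hx hij).2 h0⟩

theorem IsAdapted.notMem_support_of_torus (hφ : D.IsAdapted φ label) {x : X} (hx : x ∈ φ.source)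
    (h : φ x ∈ torus n) : x ∉ D.support := fun hs => by
  obtain ⟨i, j, -, h0⟩ := (IsAdapted.mem_support_iff hφ hx).1 hs
  exact h i h0

theorem weight_of_none {i : Fin n} (h : label i = none) : D.weight label i = 0 := by
  simp [weight, h]

theorem weight_of_some {i : Fin n} {j : Fin D.numComp} (h : label i = some j) :
    D.weight label i = D.coeff j := by
  simp [weight, h]

theorem weight_nonneg (label : Fin n → Option (Fin D.numComp)) (i : Fin n) :
    0 ≤ D.weight label i := by
  rcases h : label i with _ | j
  · exact (weight_of_none h).ge
  · rw [weight_of_some h]; exact (D.coeff_pos j).le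

theorem weight_le_one (label : Fin n → Option (Fin D.numComp)) (i : Fin n) :
    D.weight label i ≤ 1 := by
  rcases h : label i with _ | j
  · rw [weight_of_none h]; exact zero_le_one
  · rw [weight_of_some h]; exact D.coeff_le_one j

/-- The order `⌊mᵢ cᵢ⌋` of the pole of `frame φ label h` along the `i`-th hyperplane. -/
def poleOrder (label : Fin n → Option (Fin D.numComp)) (h : Fin m → Fin n) (i : Fin n) : ℕ :=
  ⌊(Fintype.card {k // h k = i} : ℚ) * D.weight label i⌋₊

theorem poleOrder_of_none {h : Fin m → Fin n} {i : Fin n} (hi : label i = none) :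
    poleOrder (D := D) label h i = 0 := by
  simp [poleOrder, weight_of_none hi]

theorem frame_eq (φ : OpenPartialHomeomorph X (Fin n → ℂ))
    (label : Fin n → Option (Fin D.numComp)) (h : Fin m → Fin n) (x : X) :
    D.frame φ label h x =
      (∏ i, (φ x i)⁻¹ ^ poleOrder label h i) • tensorOf fun k => dcoord φ (h k) x := rfl

theorem IsAdapted.pole_ne_zero (hφ : D.IsAdapted φ label) {x : X} (hx : x ∈ φ.source)
    (hxs : x ∉ D.support) (h : Fin m → Fin n) : ∏ i, (φ x i)⁻¹ ^ poleOrder label h i ≠ 0 := by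
  refine Finset.prod_ne_zero_iff.2 fun i _ => ?_
  rcases hi : label i with _ | j
  · rw [poleOrder_of_none hi]; simp
  · exact pow_ne_zero _ (inv_ne_zero fun h0 =>
      hxs ((IsAdapted.mem_support_iff hφ hx).2 ⟨i, j, hi, h0⟩))

theorem IsAdapted.frame_independent [IsManifold 𝓘(ℂ, Fin n → ℂ) ω X] (hφ : D.IsAdapted φ label)
    {x : X} (hx : x ∈ φ.source) (hxs : x ∉ D.support) {c : (Fin m → Fin n) → ℂ}
    (h : ∑ h, c h • D.frame φ label h x = 0) (a : Fin m → Fin n) : c a = 0 := by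
  simp only [frame_eq, smul_smul] at h
  have := eq_zero_of_sum_smul_tensorOf_dcoord hφ.mem_atlas hx h a
  exact (mul_eq_zero.1 this).resolve_right (IsAdapted.pole_ne_zero hφ hx hxs a)

theorem IsAdapted.frame_coeff_unique [IsManifold 𝓘(ℂ, Fin n → ℂ) ω X] (hφ : D.IsAdapted φ label)
    {x : X} (hx : x ∈ φ.source) (hxs : x ∉ D.support) {c c' : (Fin m → Fin n) → ℂ}
    (h : ∑ h, c h • D.frame φ label h x = ∑ h, c' h • D.frame φ label h x) : c = c' := by
  funext a
  refine sub_eq_zero.1 (IsAdapted.frame_independent hφ hx hxs (c := fun a => c a - c' a) ?_ a)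
  ext v
  have h' := congrArg (fun t => t v) h
  simp only [sum_apply, smul_apply, smul_eq_mul] at h'
  simp only [sum_apply, smul_apply, smul_eq_mul, sub_mul, Finset.sum_sub_distrib, h', sub_self,
    zero_apply]

end SmoothOrbifoldDivisor

end Divisor

theorem differentiableAt_finset_prod {E ι : Type*} [NormedAddCommGroup E] [NormedSpace ℂ E]
    (s : Finset ι) {f : ι → E → ℂ} {x : E} (h : ∀ i, DifferentiableAt ℂ (f i) x) :
    DifferentiableAt ℂ (fun z => ∏ i ∈ s, f i z) x := by
  classical
  induction s using Finset.induction_on with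
  | empty => simp
  | insert i s hi ih => simpa only [Finset.prod_insert hi] using! (h i).mul ih

theorem mdifferentiableAt_finset_sum {n : ℕ} {M ι : Type*} [TopologicalSpace M]
    [ChartedSpace (Fin n → ℂ) M] (s : Finset ι) {f : ι → M → ℂ} {x : M}
    (h : ∀ i, MDifferentiableAt 𝓘(ℂ, Fin n → ℂ) 𝓘(ℂ, ℂ) (f i) x) :
    MDifferentiableAt 𝓘(ℂ, Fin n → ℂ) 𝓘(ℂ, ℂ) (fun z => ∑ i ∈ s, f i z) x := by
  classical
  induction s using Finset.induction_on with
  | empty => simpa using mdifferentiableAt_const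
  | insert i s hi ih => simpa only [Finset.sum_insert hi] using! (h i).add ih

/-- For j ≠ i, lines in the j-th direction through a point of {z_i = 0} stay in that hyperplane,
where F is zero. The derivative thus vanishes there too and the previous estimate applies to it. -/
theorem fderiv_isBigO_coord_of_vanishing {n : ℕ} {F : (Fin n → ℂ) → ℂ} {q : Fin n → ℂ}
    {i j : Fin n} (hF : ContDiffAt ℂ 2 F q) (hq : q i = 0) (h : ∀ᶠ z in 𝓝 q, z i = 0 → F z = 0)
    (hj : j ≠ i) : (fun z => fderiv ℂ F z (Pi.single j 1)) =O[𝓝 q] fun z => z i := by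
  refine isBigO_coord_of_vanishing ?_ hq ?_
  · exact (hF.fderiv_right (m := 1) (by norm_num)).clm_apply contDiffAt_const
  · have hd : ∀ᶠ z in 𝓝 q, DifferentiableAt ℂ F z :=
      (hF.eventually (by simp)).mono fun z hz => hz.differentiableAt (by simp)
    filter_upwards [h.eventually_nhds, hd] with z hz hdz hzi
    have hline : HasDerivAt (fun t : ℂ => z + t • (Pi.single j 1 : Fin n → ℂ))
        (Pi.single j 1) 0 := by
      simpa using ((hasDerivAt_id (0 : ℂ)).smul_const (Pi.single j 1 : Fin n → ℂ)).const_add z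
    have h1 : HasDerivAt (fun t : ℂ => F (z + t • (Pi.single j 1 : Fin n → ℂ)))
        (fderiv ℂ F z (Pi.single j 1)) 0 :=
      HasFDerivAt.comp_hasDerivAt (l := F) (l' := fderiv ℂ F z) 0
        (by simpa using hdz.hasFDerivAt) hline
    have h2 : (fun t : ℂ => F (z + t • (Pi.single j 1 : Fin n → ℂ))) =ᶠ[𝓝 0] fun _ => 0 := by
      have hc : Tendsto (fun t : ℂ => z + t • (Pi.single j 1 : Fin n → ℂ)) (𝓝 0) (𝓝 z) := by
        simpa using hline.continuousAt.tendsto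
      filter_upwards [hc.eventually hz] with t ht
      exact ht (by simp [hzi, hj.symm])
    exact h1.unique ((hasDerivAt_const (0 : ℂ) (0 : ℂ)).congr_of_eventuallyEq h2)

theorem eventually_mem_transition {n : ℕ} {X : Type*} [TopologicalSpace X]
    {φ φ' : OpenPartialHomeomorph X (Fin n → ℂ)} {z : Fin n → ℂ}
    (hz : z ∈ φ'.target) (hz' : φ'.symm z ∈ φ.source) :
    ∀ᶠ w in 𝓝 z, w ∈ φ'.target ∧ φ'.symm w ∈ φ.source :=
  (φ'.open_target.eventually_mem hz).and
    ((φ'.continuousAt_symm hz).eventually (φ.open_source.eventually_mem hz'))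

/-! ### Holomorphic change of frame between adapted charts. -/

section Transition

variable {n m : ℕ} {X : Type*} [TopologicalSpace X] [ChartedSpace (Fin n → ℂ) X]
  {D : SmoothOrbifoldDivisor n X} {φ φ' : OpenPartialHomeomorph X (Fin n → ℂ)}
  {label label' : Fin n → Option (Fin D.numComp)}

theorem contDiffAt_transition (hφ : φ ∈ IsManifold.maximalAtlas 𝓘(ℂ, Fin n → ℂ) ω X)
    (hφ' : φ' ∈ IsManifold.maximalAtlas 𝓘(ℂ, Fin n → ℂ) ω X) {z : Fin n → ℂ}
    (hz : z ∈ φ'.target) (hz' : φ'.symm z ∈ φ.source) :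
    ContDiffAt ℂ ω (fun w => φ (φ'.symm w)) z :=
  ((contMDiffAt_of_mem_maximalAtlas hφ hz').comp z
    (contMDiffAt_symm_of_mem_maximalAtlas hφ' hz)).contDiffAt

theorem contDiffAt_transition_coord (hφ : φ ∈ IsManifold.maximalAtlas 𝓘(ℂ, Fin n → ℂ) ω X)
    (hφ' : φ' ∈ IsManifold.maximalAtlas 𝓘(ℂ, Fin n → ℂ) ω X) {z : Fin n → ℂ}
    (hz : z ∈ φ'.target) (hz' : φ'.symm z ∈ φ.source) (i : Fin n) :
    ContDiffAt ℂ ω (fun w => φ (φ'.symm w) i) z :=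
  contDiffAt_pi.1 (contDiffAt_transition hφ hφ' hz hz') i

theorem dcoord_eq_sum (hφ : φ ∈ IsManifold.maximalAtlas 𝓘(ℂ, Fin n → ℂ) ω X)
    (hφ' : φ' ∈ IsManifold.maximalAtlas 𝓘(ℂ, Fin n → ℂ) ω X) {x : X}
    (hx : x ∈ φ.source) (hx' : x ∈ φ'.source) (i : Fin n) :
    dcoord φ i x = ∑ j, fderiv ℂ (fun w => φ (φ'.symm w) i) (φ' x) (Pi.single j 1) •
      dcoord φ' j x := by
  have h := (contDiffAt_transition_coord hφ hφ' (φ'.map_source hx')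
    (by rwa [φ'.left_inv hx']) i).differentiableAt (by simp)
  rw [← differential_comp_chart_eq_sum hφ' hx' h, dcoord_eq_differential]
  refine differential_congr ?_
  filter_upwards [φ'.open_source.mem_nhds hx'] with z hz
  rw [φ'.left_inv hz]

variable (D) in
/-- The coefficients of the frame of the chart `φ` with respect to the frame of the chart `φ'`, in
the coordinates `φ'`. -/
noncomputable def transitionCoeff (φ φ' : OpenPartialHomeomorph X (Fin n → ℂ))
    (label label' : Fin n → Option (Fin D.numComp)) (h h' : Fin m → Fin n) (z : Fin n → ℂ) : ℂ :=
  ((∏ i, (φ (φ'.symm z) i)⁻¹ ^ SmoothOrbifoldDivisor.poleOrder (D := D) label h i) *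
    ∏ i, z i ^ SmoothOrbifoldDivisor.poleOrder (D := D) label' h' i) *
    ∏ k, fderiv ℂ (fun w => φ (φ'.symm w) (h k)) z (Pi.single (h' k) 1)

open SmoothOrbifoldDivisor

theorem frame_eq_sum_transitionCoeff (hφ : D.IsAdapted φ label) (hφ' : D.IsAdapted φ' label')
    {x : X} (hx : x ∈ φ.source) (hx' : x ∈ φ'.source) (hxs : x ∉ D.support) (h : Fin m → Fin n) :
    D.frame φ label h x =
      ∑ h', transitionCoeff D φ φ' label label' h h' (φ' x) • D.frame φ' label' h' x := by
  rw [frame_eq]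
  have h1 : (fun k => dcoord φ (h k) x) = fun k => ∑ j,
      fderiv ℂ (fun w => φ (φ'.symm w) (h k)) (φ' x) (Pi.single j 1) • dcoord φ' j x :=
    funext fun k => dcoord_eq_sum hφ.mem_atlas hφ'.mem_atlas hx hx' (h k)
  rw [h1, tensorOf_sum, Finset.smul_sum]
  refine Finset.sum_congr rfl fun h' _ => ?_
  rw [frame_eq, smul_smul, smul_smul]
  congr 1
  have h2 : (∏ i, φ' x i ^ poleOrder (D := D) label' h' i) *
      ∏ i, (φ' x i)⁻¹ ^ poleOrder (D := D) label' h' i = 1 := by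
    have := IsAdapted.pole_ne_zero hφ' hx' hxs h'
    simp only [inv_pow, Finset.prod_inv_distrib] at this ⊢
    exact mul_inv_cancel₀ fun h0 => this (by rw [h0, inv_zero])
  rw [transitionCoeff, φ'.left_inv hx']
  linear_combination (-((∏ i, (φ x i)⁻¹ ^ poleOrder (D := D) label h i) *
    ∏ k, fderiv ℂ (fun w => φ (φ'.symm w) (h k)) (φ' x) (Pi.single (h' k) 1))) * h2

theorem differentiableAt_transitionCoeff (hφ : D.IsAdapted φ label) (hφ' : D.IsAdapted φ' label')
    {z : Fin n → ℂ} (hz : z ∈ φ'.target) (hz' : φ'.symm z ∈ φ.source)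
    (hzs : φ'.symm z ∉ D.support) (h h' : Fin m → Fin n) :
    DifferentiableAt ℂ (transitionCoeff D φ φ' label label' h h') z := by
  have hτ := contDiffAt_transition_coord hφ.mem_atlas hφ'.mem_atlas hz hz'
  refine DifferentiableAt.mul (DifferentiableAt.mul ?_ ?_) ?_
  · refine differentiableAt_finset_prod _ fun i => ?_
    rcases hi : label i with _ | j
    · simp [poleOrder_of_none hi]
    · exact (((hτ i).differentiableAt (by simp)).fun_inv fun h0 =>
        hzs ((IsAdapted.mem_support_iff hφ hz').2 ⟨i, j, hi, h0⟩)).fun_pow _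
  · fun_prop
  · refine differentiableAt_finset_prod _ fun k => ?_
    exact ((((hτ (h k)).fderiv_right (m := 1) (by simp)).clm_apply
      contDiffAt_const).differentiableAt (by simp))

/-- A slot in h⁻¹(i) either lies in h'⁻¹(i') or is one of the slots counted last. As the weight is
at most 1, each of the latter contributes at most 1 inside the floor. -/
theorem poleOrder_le {h h' : Fin m → Fin n} {i i' : Fin n}
    (hc : D.weight label i = D.weight label' i') :
    poleOrder (D := D) label h i ≤ poleOrder (D := D) label' h' i' +
      Fintype.card {k // h k = i ∧ h' k ≠ i'} := by
  classical
  have hcard : Fintype.card {k // h k = i} ≤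
      Fintype.card {k // h' k = i'} + Fintype.card {k // h k = i ∧ h' k ≠ i'} := by
    simp only [Fintype.card_subtype]
    refine (Finset.card_le_card fun k hk => ?_).trans (Finset.card_union_le _ _)
    simp only [Finset.mem_union, Finset.mem_filter, Finset.mem_univ, true_and] at hk ⊢
    tauto
  rw [poleOrder, poleOrder, ← Nat.floor_add_natCast
    (mul_nonneg (Nat.cast_nonneg _) (weight_nonneg _ _)), hc]
  refine Nat.floor_le_floor ?_
  have h0 := weight_nonneg label' i'
  have h1 := weight_le_one label' i'
  have h2 : (Fintype.card {k // h k = i} : ℚ) ≤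
      Fintype.card {k // h' k = i'} + Fintype.card {k // h k = i ∧ h' k ≠ i'} := by
    exact_mod_cast hcard
  have h3 := mul_le_mul_of_nonneg_right h2 h0
  have h4 : (Fintype.card {k // h k = i ∧ h' k ≠ i'} : ℚ) * D.weight label' i' ≤
      Fintype.card {k // h k = i ∧ h' k ≠ i'} := mul_le_of_le_one_right (Nat.cast_nonneg _) h1
  linarith

/-- Near a point of a single component of the divisor, the local equations of that component in two
adapted charts bound each other. -/
theorem coord_isBigO_transition (hφ : D.IsAdapted φ label) (hφ' : D.IsAdapted φ' label')
    {z : Fin n → ℂ} (hz : z ∈ φ'.target) (hz' : φ'.symm z ∈ φ.source) {i i' : Fin n}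
    {j : Fin D.numComp} (hi : label i = some j) (hi' : label' i' = some j) (h0 : z i' = 0) :
    (fun w => w i') =O[𝓝 z] fun w => φ (φ'.symm w) i := by
  have hcont : Tendsto (fun w => φ (φ'.symm w)) (𝓝 z) (𝓝 (φ (φ'.symm z))) :=
    (contDiffAt_transition hφ.mem_atlas hφ'.mem_atlas hz hz').continuousAt
  have hy : φ (φ'.symm z) ∈ φ.target := φ.map_source hz'
  have hy' : φ.symm (φ (φ'.symm z)) ∈ φ'.source := by
    rw [φ.left_inv hz']; exact φ'.map_target hz
  have hzero : φ (φ'.symm z) i = 0 := by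
    rw [← IsAdapted.mem_comp_iff hφ hz' hi, IsAdapted.mem_comp_iff hφ' (φ'.map_target hz) hi',
      φ'.right_inv hz, h0]
  have h1 : (fun u => φ' (φ.symm u) i') =O[𝓝 (φ (φ'.symm z))] fun u => u i := by
    refine isBigO_coord_of_vanishing
      ((contDiffAt_transition_coord hφ'.mem_atlas hφ.mem_atlas hy hy' i').of_le (by simp)) hzero ?_
    filter_upwards [eventually_mem_transition hy hy'] with u hu hu0
    rw [← IsAdapted.mem_comp_iff hφ' hu.2 hi', IsAdapted.mem_comp_iff hφ (φ.map_target hu.1) hi,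
      φ.right_inv hu.1, hu0]
  refine (h1.comp_tendsto hcont).congr' ?_ (EventuallyEq.refl _ _)
  filter_upwards [eventually_mem_transition hz hz'] with w hw
  simp only [Function.comp_apply, φ.left_inv hw.2, φ'.right_inv hw.1]

theorem fderiv_transition_isBigO (hφ : D.IsAdapted φ label) (hφ' : D.IsAdapted φ' label')
    {z : Fin n → ℂ} (hz : z ∈ φ'.target) (hz' : φ'.symm z ∈ φ.source) {i i' l : Fin n}
    {j : Fin D.numComp} (hi : label i = some j) (hi' : label' i' = some j) (h0 : z i' = 0)
    (hl : l ≠ i') :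
    (fun w => fderiv ℂ (fun w => φ (φ'.symm w) i) w (Pi.single l 1)) =O[𝓝 z] fun w => w i' := by
  refine fderiv_isBigO_coord_of_vanishing
    ((contDiffAt_transition_coord hφ.mem_atlas hφ'.mem_atlas hz hz' i).of_le (by simp)) h0 ?_ hl
  filter_upwards [eventually_mem_transition hz hz'] with u hu hu0
  rw [← IsAdapted.mem_comp_iff hφ hu.2 hi, IsAdapted.mem_comp_iff hφ' (φ'.map_target hu.1) hi',
    φ'.right_inv hu.1, hu0]

/-- With t = w_{i'}, the three factors of the coefficient are O(t^{-P}), O(t^Q) and O(t^N), and P ≤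
Q + N. -/
theorem transitionCoeff_isBigO_one (hφ : D.IsAdapted φ label) (hφ' : D.IsAdapted φ' label')
    {z : Fin n → ℂ} (hz : z ∈ φ'.target) (hz' : φ'.symm z ∈ φ.source) {i' : Fin n}
    {j : Fin D.numComp} (hi' : label' i' = some j) (h0 : z i' = 0)
    (hne : ∀ l, l ≠ i' → z l ≠ 0) (h h' : Fin m → Fin n) :
    transitionCoeff D φ φ' label label' h h' =O[𝓝[torus n] z] fun _ => (1 : ℂ) := by
  classical
  have hτ := contDiffAt_transition_coord hφ.mem_atlas hφ'.mem_atlas hz hz'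
  have hy' : φ'.symm z ∈ φ'.source := φ'.map_target hz
  have hyc : φ'.symm z ∈ D.comp j :=
    (IsAdapted.mem_comp_iff hφ' hy' hi').2 (by rw [φ'.right_inv hz, h0])
  obtain ⟨i, hi⟩ := hφ.label_surj j ⟨_, hz', hyc⟩
  -- The point lies on no other component, so only the i-th coordinate of `φ` can produce a pole.
  have hother : ∀ l, l ≠ i → ∀ j', label l = some j' → φ (φ'.symm z) l ≠ 0 := by
    intro l hl j' hj' hl0
    have h1 := (IsAdapted.mem_comp_iff hφ hz' hj').2 hl0
    obtain ⟨l', hl'⟩ := hφ'.label_surj j' ⟨_, hy', h1⟩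
    have h2 := (IsAdapted.mem_comp_iff hφ' hy' hl').1 h1
    rw [φ'.right_inv hz] at h2
    have h3 : l' = i' := by_contra fun h => hne l' h h2
    subst h3
    have h4 : j' = j := Option.some.inj (hl'.symm.trans hi')
    subst h4
    exact hl (hφ.label_inj l i _ hj' hi)
  set P := poleOrder (D := D) label h i with hP
  set Q := poleOrder (D := D) label' h' i' with hQ
  set N := Fintype.card {k // h k = i ∧ h' k ≠ i'} with hN
  have hPQ : P ≤ Q + N := poleOrder_le (by rw [weight_of_some hi, weight_of_some hi'])
  have hcont1 : ∀ f : (Fin n → ℂ) → ℂ, ContinuousAt f z → f =O[𝓝[torus n] z] fun _ => (1 : ℂ) :=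
    fun f hf => (hf.tendsto.isBigO_one ℂ).mono nhdsWithin_le_nhds
  have hA : (fun w => ∏ l, (φ (φ'.symm w) l)⁻¹ ^ poleOrder (D := D) label h l) =O[𝓝[torus n] z]
      fun w => (w i')⁻¹ ^ P := by
    have h1 := Asymptotics.IsBigO.finsetProd (s := Finset.univ) (l := 𝓝[torus n] z)
      (f := fun l w => (φ (φ'.symm w) l)⁻¹ ^ poleOrder (D := D) label h l)
      (g := fun l w => if l = i then (w i')⁻¹ ^ P else 1) fun l _ => by
        by_cases hl : l = i
        · subst hl
          simp only [if_true]
          refine Asymptotics.IsBigO.pow (Asymptotics.IsBigO.inv_rev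
            ((coord_isBigO_transition hφ hφ' hz hz' hi hi' h0).mono nhdsWithin_le_nhds) ?_) _
          filter_upwards [self_mem_nhdsWithin] with w hw h
          exact absurd h (hw i')
        · simp only [if_neg hl]
          refine hcont1 _ ?_
          rcases hl' : label l with _ | j'
          · simpa [poleOrder_of_none hl'] using continuousAt_const
          · exact ((hτ l).continuousAt.inv₀ (hother l hl j' hl')).pow _
    simpa using h1
  have hB : (fun w : Fin n → ℂ => ∏ l, w l ^ poleOrder (D := D) label' h' l) =O[𝓝[torus n] z]
      fun w => w i' ^ Q := by
    have h1 := Asymptotics.IsBigO.finsetProd (s := Finset.univ) (l := 𝓝[torus n] z)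
      (f := fun l (w : Fin n → ℂ) => w l ^ poleOrder (D := D) label' h' l)
      (g := fun l w => if l = i' then w i' ^ Q else 1) fun l _ => by
        by_cases hl : l = i'
        · subst hl
          simpa only [if_true] using Asymptotics.isBigO_refl _ _
        · simp only [if_neg hl]
          exact hcont1 _ ((continuous_apply l).pow _).continuousAt
    simpa using h1
  have hC : (fun w => ∏ k, fderiv ℂ (fun w => φ (φ'.symm w) (h k)) w (Pi.single (h' k) 1))
      =O[𝓝[torus n] z] fun w => w i' ^ N := by
    have h1 := Asymptotics.IsBigO.finsetProd (s := Finset.univ) (l := 𝓝[torus n] z)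
      (f := fun k w => fderiv ℂ (fun w => φ (φ'.symm w) (h k)) w (Pi.single (h' k) 1))
      (g := fun k w => if h k = i ∧ h' k ≠ i' then w i' else 1) fun k _ => by
        by_cases hk : h k = i ∧ h' k ≠ i'
        · simp only [if_pos hk]
          rw [hk.1]
          exact (fderiv_transition_isBigO hφ hφ' hz hz' hi hi' h0 hk.2).mono nhdsWithin_le_nhds
        · simp only [if_neg hk]
          exact hcont1 _ (((hτ (h k)).fderiv_right (m := 0) (by simp)).clm_apply
            contDiffAt_const).continuousAt
    refine h1.congr_right fun w => ?_
    rw [Finset.prod_ite, Finset.prod_const, Finset.prod_const_one, mul_one, hN,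
      Fintype.card_subtype]
  refine ((hA.mul hB).mul hC).trans ?_
  have h2 : (fun w : Fin n → ℂ => (w i')⁻¹ ^ P * w i' ^ Q * w i' ^ N) =ᶠ[𝓝[torus n] z]
      fun w => w i' ^ (Q + N - P) := by
    filter_upwards [self_mem_nhdsWithin] with w hw
    have hw' := hw i'
    rw [mul_assoc, ← pow_add, inv_pow, pow_sub₀ _ hw' hPQ, mul_comm]
  exact h2.trans_isBigO (hcont1 _ ((continuous_apply i').pow _).continuousAt)

theorem transitionCoeff_tendsto (hφ : D.IsAdapted φ label) (hφ' : D.IsAdapted φ' label')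
    {z : Fin n → ℂ} (hz : z ∈ φ'.target) (hz' : φ'.symm z ∈ φ.source) {i : Fin n} (h0 : z i = 0)
    (hne : ∀ l, l ≠ i → z l ≠ 0) (h h' : Fin m → Fin n) :
    Tendsto (fun w => w i * transitionCoeff D φ φ' label label' h h' w) (𝓝[torus n] z) (𝓝 0) := by
  have hO : transitionCoeff D φ φ' label label' h h' =O[𝓝[torus n] z] fun _ => (1 : ℂ) := by
    rcases hi : label' i with _ | j
    · have hs : φ'.symm z ∉ D.support := fun hs => by
        obtain ⟨l, j, hl, hl0⟩ := (IsAdapted.mem_support_iff hφ' (φ'.map_target hz)).1 hs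
        rw [φ'.right_inv hz] at hl0
        by_cases hli : l = i
        · subst hli; simp [hi] at hl
        · exact hne l hli hl0
      exact ((differentiableAt_transitionCoeff hφ hφ' hz hz' hs h h').continuousAt.tendsto.isBigO_one
        ℂ).mono nhdsWithin_le_nhds
    · exact transitionCoeff_isBigO_one hφ hφ' hz hz' hi h0 hne h h'
  have hc : Tendsto (fun w : Fin n → ℂ => w i) (𝓝[torus n] z) (𝓝 0) := by
    rw [← h0]
    exact ((continuous_apply i).tendsto z).mono_left nhdsWithin_le_nhds
  have h1 := (Asymptotics.isBigO_refl (fun w : Fin n → ℂ => w i) (𝓝[torus n] z)).mul hO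
  simp only [mul_one] at h1
  exact h1.trans_tendsto hc

theorem exists_frame_change (hφ : D.IsAdapted φ label) (hφ' : D.IsAdapted φ' label') {p : X}
    (hp : p ∈ φ.source) (hp' : p ∈ φ'.source) (h h' : Fin m → Fin n) :
    ∃ a : X → ℂ, ∀ᶠ x in 𝓝 p, MDifferentiableAt 𝓘(ℂ, Fin n → ℂ) 𝓘(ℂ, ℂ) a x ∧
      (x ∉ D.support → a x = transitionCoeff D φ φ' label label' h h' (φ' x)) := by
  have hz : φ' p ∈ φ'.target := φ'.map_source hp'
  have hz' : φ'.symm (φ' p) ∈ φ.source := by rwa [φ'.left_inv hp']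
  have hev := eventually_mem_transition hz hz'
  obtain ⟨g, hg⟩ := exists_holomorphic_extension (φ' p)
    (transitionCoeff D φ φ' label label' h h')
    (hev.mono fun z hz ht => differentiableAt_transitionCoeff hφ hφ' hz.1 hz.2
      (IsAdapted.notMem_support_of_torus hφ' (φ'.map_target hz.1)
        (by rwa [φ'.right_inv hz.1])) h h')
    (hev.mono fun z hz i h0 hne => transitionCoeff_tendsto hφ hφ' hz.1 hz.2 h0 hne h h')
  have hg' : ∀ᶠ x in 𝓝 p, DifferentiableAt ℂ g (φ' x) ∧ (φ' x ∈ torus n →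
      g (φ' x) = transitionCoeff D φ φ' label label' h h' (φ' x)) :=
    (φ'.continuousAt hp').eventually hg
  refine ⟨fun x => g (φ' x), ?_⟩
  filter_upwards [hg'.eventually_nhds, φ.open_source.eventually_mem hp,
    φ'.open_source.eventually_mem hp', (φ'.open_source.eventually_mem hp').eventually_nhds,
    (φ.open_source.eventually_mem hp).eventually_nhds] with x hx hxs hxs' hxn' hxn
  refine ⟨mdifferentiableAt_comp_chart hφ'.mem_atlas hxs' hx.self_of_nhds.1, fun hsupp => ?_⟩
  have hopen : ∀ᶠ y in 𝓝 x, y ∉ D.support :=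
    (isClosed_iUnion_of_finite D.comp_closed).isOpen_compl.eventually_mem hsupp
  -- The extension agrees with the coefficient only on the torus a priori. Off the support both are
  -- continuous, so agreement passes to hyperplanes that are not components.
  refine (eventuallyEq_of_torus φ' hxs' (f := fun x => g (φ' x))
    (g := fun x => transitionCoeff D φ φ' label label' h h' (φ' x)) ?_ ?_ ?_).self_of_nhds
  · filter_upwards [hx, hxn'] with y hy hys
    exact (hy.1.continuousAt).comp (φ'.continuousAt hys)
  · filter_upwards [hopen, hxn', hxn] with y hy hys' hys
    exact (differentiableAt_transitionCoeff hφ hφ' (φ'.map_source hys')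
      (by rwa [φ'.left_inv hys']) (by rwa [φ'.left_inv hys']) h h').continuousAt.comp
      (φ'.continuousAt hys')
  · filter_upwards [hx] with y hy using hy.2

end Transition

theorem sum_smul_coTensor {n m : ℕ} {M ι : Type*} [TopologicalSpace M] [ChartedSpace (Fin n → ℂ) M]
    [Fintype ι] {x : M} (c : ι → ℂ) (t : CoTensor n m x) : (∑ i, c i) • t = ∑ i, c i • t := by
  ext v
  simp [Finset.sum_mul]

/-! ### Independence of the chart and local freeness. -/

section Free

variable {n m : ℕ} {X : Type*} [TopologicalSpace X] [ChartedSpace (Fin n → ℂ) X]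
  {D : SmoothOrbifoldDivisor n X} {φ φ' : OpenPartialHomeomorph X (Fin n → ℂ)}
  {label label' : Fin n → Option (Fin D.numComp)}

open SmoothOrbifoldDivisor

theorem LocallyGenerated.frame_change (hφ : D.IsAdapted φ label) (hφ' : D.IsAdapted φ' label')
    {U : Opens X} {s : TensorField n m D.support U} {p : X} (hp : p ∈ φ.source)
    (hp' : p ∈ φ'.source) (hs : LocallyGenerated (fun h : Fin m → Fin n => D.frame φ label h) s p) :
    LocallyGenerated (fun h : Fin m → Fin n => D.frame φ' label' h) s p := by
  obtain ⟨f, hf⟩ := hs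
  choose a ha using fun h h' : Fin m → Fin n => exists_frame_change hφ hφ' hp hp' h h'
  refine ⟨fun h' x => ∑ h, f h x * a h h' x, ?_⟩
  filter_upwards [hf, eventually_all.2 fun h => eventually_all.2 fun h' => ha h h',
    φ.open_source.eventually_mem hp, φ'.open_source.eventually_mem hp'] with x hx hax hxs hxs'
  refine ⟨fun h' => mdifferentiableAt_finset_sum _ fun h => (hx.1 h).mul (hax h h').1,
    fun hxU => ?_⟩
  rw [hx.2 hxU]
  simp only [frame_eq_sum_transitionCoeff hφ hφ' hxs hxs' hxU.2, Finset.smul_sum, smul_smul]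
  rw [Finset.sum_comm]
  refine Finset.sum_congr rfl fun h' _ => ?_
  rw [sum_smul_coTensor]
  exact Finset.sum_congr rfl fun h _ => by rw [(hax h h').2 hxU.2]

/-- The change of frame is holomorphic, so one adapted chart around each point suffices to test the
condition imposed in all of them. -/
theorem mem_integralTensors_of_locally {U : Opens X} {s : TensorField n m D.support U}
    (h : ∀ x ∈ U, ∃ φ label, D.IsAdapted φ label ∧ x ∈ φ.source ∧
      LocallyGenerated (fun h : Fin m → Fin n => D.frame φ label h) s x) :
    s ∈ D.integralTensors m U := by
  intro φ' label' hφ' x hx hxU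
  obtain ⟨φ, label, hφ, hxφ, hs⟩ := h x hxU
  exact hs.frame_change hφ hφ' hxφ hx

theorem sum_smul_apply {M : Type*} [TopologicalSpace M] [ChartedSpace (Fin n → ℂ) M] {Z : Set M}
    {U : Opens M} {ι : Type*} [Fintype ι] (f : ι → holo n U)
    (t : ι → TensorField n m Z U) (x : {x : M // x ∈ U ∧ x ∉ Z}) :
    (∑ h, f h • t h) x = ∑ h, (f h : U → ℂ) ⟨x, x.2.1⟩ • t h x := by
  let ev : TensorField n m Z U →+ CoTensor n m (x : M) :=
    { toFun := fun s => s x, map_zero' := rfl, map_add' := fun _ _ => rfl }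
  exact map_sum ev _ _

theorem locallyGenerated_of_eq_sum {V : Opens X} {s : TensorField n m D.support V}
    {f : (Fin m → Fin n) → holo n V} (hs : s = ∑ h, f h • D.frameOn φ label h V) {x : X}
    (hx : x ∈ V) : LocallyGenerated (fun h : Fin m → Fin n => D.frame φ label h) s x := by
  choose F hF hFd using fun h => exists_extension (f h)
  refine ⟨F, ?_⟩
  filter_upwards [V.isOpen.eventually_mem hx] with y hy
  refine ⟨fun h => hFd h y hy, fun hyV => ?_⟩
  rw [hs, sum_smul_apply]
  exact Finset.sum_congr rfl fun h _ => by rw [hF h y hy]; rfl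

variable [IsManifold 𝓘(ℂ, Fin n → ℂ) ω X]

theorem IsAdapted.eventually_coeff_unique (hφ : D.IsAdapted φ label) {p : X} (hp : p ∈ φ.source)
    {f g : (Fin m → Fin n) → X → ℂ} (hf : ∀ h, ∀ᶠ x in 𝓝 p, ContinuousAt (f h) x)
    (hg : ∀ h, ∀ᶠ x in 𝓝 p, ContinuousAt (g h) x)
    (heq : ∀ᶠ x in 𝓝 p, φ x ∈ torus n →
      ∑ h, f h x • D.frame φ label h x = ∑ h, g h x • D.frame φ label h x) (h : Fin m → Fin n) :
    ∀ᶠ x in 𝓝 p, f h x = g h x := by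
  refine eventuallyEq_of_torus φ hp (hf h) (hg h) ?_
  filter_upwards [heq, φ.open_source.eventually_mem hp] with x hx hxs ht
  exact congrFun (IsAdapted.frame_coeff_unique hφ hxs
    (IsAdapted.notMem_support_of_torus hφ hxs ht) (c := fun h => f h x) (c' := fun h => g h x)
    (hx ht)) h

theorem mem_integralTensors_iff (hφ : D.IsAdapted φ label) {V : Opens X}
    (hV : (V : Set X) ⊆ φ.source) (s : TensorField n m D.support V) :
    s ∈ D.integralTensors m V ↔
      ∃! f : (Fin m → Fin n) → holo n V, s = ∑ h, f h • D.frameOn φ label h V := by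
  constructor
  · intro hs
    have hloc : ∀ x : V, LocallyGenerated (fun h : Fin m → Fin n => D.frame φ label h) s x :=
      fun x => hs φ label hφ x (hV x.2) x.2
    choose f hf using hloc
    have hcont : ∀ (x : V) h, ∀ᶠ y in 𝓝 (x : X), ContinuousAt (f x h) y := fun x h =>
      (hf x).mono fun y hy => (hy.1 h).continuousAt
    -- Coefficients chosen around different points coincide near common points by uniqueness. Hence
    -- the diagonal x ↦ `f x h x` is locally one of these holomorphic functions.
    have hagree : ∀ (x : V) h, ∀ᶠ y in 𝓝 (x : X), ∀ hy : y ∈ V, f ⟨y, hy⟩ h y = f x h y := by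
      intro x h
      filter_upwards [(hf x).eventually_nhds, (hcont x h).eventually_nhds] with y hy hyc hyV
      refine (IsAdapted.eventually_coeff_unique hφ (hV hyV) (hcont ⟨y, hyV⟩)
        (fun h => hy.mono fun z hz => (hz.1 h).continuousAt) ?_ h).self_of_nhds
      filter_upwards [hy, hf ⟨y, hyV⟩, V.isOpen.eventually_mem hyV] with z hz hz' hzV ht
      have hzs := IsAdapted.notMem_support_of_torus hφ (hV hzV) ht
      exact (hz'.2 ⟨hzV, hzs⟩).symm.trans (hz.2 ⟨hzV, hzs⟩)
    let g : (Fin m → Fin n) → holo n V := fun h => ⟨fun x => f x h x, fun x => by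
      have h1 : MDifferentiableAt 𝓘(ℂ, Fin n → ℂ) 𝓘(ℂ, ℂ) (fun z : V => f x h z) x :=
        mdifferentiableAt_restrict_iff.2 ((hf x).self_of_nhds.1 h)
      refine h1.congr_of_eventuallyEq ?_
      have h2 := continuous_subtype_val.continuousAt.eventually (hagree x h)
      filter_upwards [h2] with y hy using hy y.2⟩
    refine ⟨g, ?_, ?_⟩
    · funext x
      rw [sum_smul_apply]
      exact (hf ⟨x, x.2.1⟩).self_of_nhds.2 x.2
    · intro g' hg'
      funext h
      refine Subtype.ext (funext fun x => ?_)
      choose G hG hGd using fun h => exists_extension (g' h)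
      rw [← hG h x x.2]
      refine (IsAdapted.eventually_coeff_unique hφ (hV x.2) (g := f x)
        (fun h => ?_) (hcont x) ?_ h).self_of_nhds
      · filter_upwards [V.isOpen.eventually_mem x.2] with y hy using (hGd h y hy).continuousAt
      · filter_upwards [hf x, V.isOpen.eventually_mem x.2] with y hy hyV ht
        have hys := IsAdapted.notMem_support_of_torus hφ (hV hyV) ht
        rw [← hy.2 ⟨hyV, hys⟩, hg', sum_smul_apply]
        exact Finset.sum_congr rfl fun h _ => by rw [hG h y hyV]; rfl
  · rintro ⟨f, hf, -⟩
    exact mem_integralTensors_of_locally fun x hx =>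
      ⟨φ, label, hφ, hV hx, locallyGenerated_of_eq_sum hf hx⟩

end Free

/-! ### Descent of functions along the power map. -/

section Power

variable {n : ℕ}

/-- The map `w ↦ (wᵢ^(kᵢ))ᵢ` of `ℂⁿ`. -/
def powerMap (k : Fin n → ℕ) (w : Fin n → ℂ) : Fin n → ℂ := fun i => w i ^ k i

theorem continuous_powerMap (k : Fin n → ℕ) : Continuous (powerMap k) :=
  continuous_pi fun i => (continuous_apply i).pow _

theorem powerMap_mem_torus {k : Fin n → ℕ} (hk : ∀ i, 0 < k i) {w : Fin n → ℂ} :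
    powerMap k w ∈ torus n ↔ w ∈ torus n :=
  forall_congr' fun i => pow_ne_zero_iff (hk i).ne'

theorem isOpenMap_complex_pow {k : ℕ} (hk : 0 < k) : IsOpenMap fun z : ℂ => z ^ k := by
  have h : AnalyticOnNhd ℂ (fun z : ℂ => z ^ k) Set.univ := fun z _ => analyticAt_id.pow k
  rcases h.is_constant_or_isOpen isPreconnected_univ with ⟨w, hw⟩ | h
  · have h0 := hw 0 trivial
    have h1 := hw 1 trivial
    simp only [zero_pow hk.ne', one_pow] at h0 h1
    exact absurd (h0.trans h1.symm) zero_ne_one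
  · exact fun s hs => h s (Set.subset_univ s) hs

theorem isOpenMap_powerMap {k : Fin n → ℕ} (hk : ∀ i, 0 < k i) : IsOpenMap (powerMap k) :=
  IsOpenMap.piMap (f := fun i (z : ℂ) => z ^ k i) (fun i => isOpenMap_complex_pow (hk i)) (by simp)

/-- A local inverse of `powerMap k` near the image of a point `w` of the torus. -/
noncomputable def rootMap (k : Fin n → ℕ) (w z : Fin n → ℂ) : Fin n → ℂ :=
  fun i => w i * Complex.exp (Complex.log (z i / w i ^ k i) / k i)

theorem rootMap_powerMap {k : Fin n → ℕ} {w : Fin n → ℂ} (hw : w ∈ torus n) :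
    rootMap k w (powerMap k w) = w := by
  funext i
  simp [rootMap, powerMap, div_self (pow_ne_zero _ (hw i))]

theorem powerMap_rootMap {k : Fin n → ℕ} (hk : ∀ i, 0 < k i) {w z : Fin n → ℂ} (hw : w ∈ torus n)
    (hz : z ∈ torus n) : powerMap k (rootMap k w z) = z := by
  funext i
  have hwi := pow_ne_zero (k i) (hw i)
  have hki : (k i : ℂ) ≠ 0 := Nat.cast_ne_zero.2 (hk i).ne'
  rw [powerMap, rootMap, mul_pow, ← Complex.exp_nat_mul, mul_div_cancel₀ _ hki,
    Complex.exp_log (div_ne_zero (hz i) hwi), mul_div_cancel₀ _ hwi]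

theorem differentiableAt_rootMap {k : Fin n → ℕ} {w : Fin n → ℂ} (hw : w ∈ torus n) :
    DifferentiableAt ℂ (rootMap k w) (powerMap k w) := by
  refine differentiableAt_pi.2 fun i => ?_
  have h1 : DifferentiableAt ℂ (fun z : Fin n → ℂ => Complex.log (z i / w i ^ k i))
      (powerMap k w) := by
    refine DifferentiableAt.clog ?_ ?_
    · simp only [div_eq_mul_inv]
      exact (differentiableAt_apply i _).mul_const _
    · simp [powerMap, div_self (pow_ne_zero _ (hw i))]
  simp only [rootMap, div_eq_mul_inv _ (k i : ℂ)]
  exact (h1.mul_const _).cexp.const_mul _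

/-- A holomorphic function on the source of a Kummer map whose product with a monomial is constant
along the fibres is, up to that monomial, the pullback of a holomorphic function. -/
theorem exists_descent {k e : Fin n → ℕ} (hke : ∀ i, e i < k i) {w₀ : Fin n → ℂ}
    {W : Set (Fin n → ℂ)} (hW : W ∈ 𝓝 w₀) {f : (Fin n → ℂ) → ℂ}
    (hf : ∀ w ∈ W, DifferentiableAt ℂ f w)
    (hinv : ∀ w ∈ W, ∀ w' ∈ W, w ∈ torus n → w' ∈ torus n → powerMap k w = powerMap k w' →
      f w * ∏ i, (w i)⁻¹ ^ e i = f w' * ∏ i, (w' i)⁻¹ ^ e i) :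
    ∃ g : (Fin n → ℂ) → ℂ, (∀ᶠ z in 𝓝 (powerMap k w₀), DifferentiableAt ℂ g z) ∧
      ∀ᶠ w in 𝓝 w₀, f w = g (powerMap k w) * ∏ i, w i ^ e i := by
  have hk : ∀ i, 0 < k i := fun i => (Nat.zero_le _).trans_lt (hke i)
  obtain ⟨C, hC⟩ : ∃ C, ∀ᶠ w in 𝓝 w₀, ‖f w‖ ≤ C := by
    have hcont := (hf w₀ (mem_of_mem_nhds hW)).continuousAt.norm
    exact ⟨‖f w₀‖ + 1, (hcont.eventually_lt_const (lt_add_one _)).mono fun _ h => h.le⟩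
  obtain ⟨V, hV, hVo, hwV⟩ := eventually_nhds_iff.1 (hC.and hW)
  let c : (Fin n → ℂ) → ℂ := fun w => f w * ∏ i, (w i)⁻¹ ^ e i
  have hcd : ∀ w ∈ V, w ∈ torus n → DifferentiableAt ℂ c w := fun w hw ht =>
    (hf w (hV w hw).2).mul (differentiableAt_finset_prod _ fun i =>
      (DifferentiableAt.fun_inv (h := fun w : Fin n → ℂ => w i) (differentiableAt_apply i w)
        (ht i)).fun_pow _)
  have hKo : IsOpen (powerMap k '' V) := isOpenMap_powerMap hk V hVo
  -- An arbitrary set-theoretic section is enough: over the torus `hinv` makes `F` independent of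
  -- it, and the local root `rootMap` gives differentiability.
  choose! σ hσV hσ using fun z (hz : z ∈ powerMap k '' V) => hz
  let F : (Fin n → ℂ) → ℂ := fun z => c (σ z)
  have hF : ∀ w ∈ V, w ∈ torus n → F (powerMap k w) = c w := fun w hw ht => by
    have hmem : powerMap k w ∈ powerMap k '' V := ⟨w, hw, rfl⟩
    exact hinv _ (hV _ (hσV _ hmem)).2 w (hV w hw).2
      ((powerMap_mem_torus hk).1 (by rw [hσ _ hmem]; exact (powerMap_mem_torus hk).2 ht)) ht
      (hσ _ hmem)
  have hFd : ∀ w ∈ V, w ∈ torus n → DifferentiableAt ℂ F (powerMap k w) := by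
    intro w hw ht
    have hroot := differentiableAt_rootMap (k := k) ht
    have h1 : DifferentiableAt ℂ (fun z => c (rootMap k w z)) (powerMap k w) :=
      DifferentiableAt.fun_comp' _ (by rw [rootMap_powerMap ht]; exact hcd w hw ht) hroot
    refine h1.congr_of_eventuallyEq ?_
    have h2 : Tendsto (rootMap k w) (𝓝 (powerMap k w)) (𝓝 w) := by
      have := hroot.continuousAt.tendsto
      rwa [rootMap_powerMap ht] at this
    filter_upwards [h2.eventually ((hVo.inter (isOpen_torus n)).eventually_mem ⟨hw, ht⟩),
      (isOpen_torus n).eventually_mem ((powerMap_mem_torus hk).2 ht)] with z hz hzt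
    rw [← hF _ hz.1 hz.2, powerMap_rootMap hk ht hzt]
  have hnear : ∀ᶠ z in 𝓝 (powerMap k w₀), z ∈ powerMap k '' V :=
    hKo.eventually_mem ⟨w₀, hwV, rfl⟩
  -- Since |w_j| = |x_j|^{1/k_j}, the bound can be written downstairs, as a function of x =
  -- `powerMap k w` alone.
  have hbound : ∀ w ∈ V, w ∈ torus n → ∀ i, ‖powerMap k w i * F (powerMap k w)‖ ≤
      C * ((‖powerMap k w i‖ ^ ((k i : ℝ)⁻¹)) ^ (k i - e i) *
        ∏ j ∈ Finset.univ.erase i, (‖powerMap k w j‖ ^ ((k j : ℝ)⁻¹))⁻¹ ^ e j) := by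
    intro w hw ht i
    have hroot : ∀ j, ‖powerMap k w j‖ ^ ((k j : ℝ)⁻¹) = ‖w j‖ := fun j => by
      rw [powerMap, norm_pow, Real.pow_rpow_inv_natCast (norm_nonneg _) (hk j).ne']
    simp only [hroot, hF w hw ht]
    have h1 : ‖powerMap k w i‖ * ‖w i‖⁻¹ ^ e i = ‖w i‖ ^ (k i - e i) := by
      rw [powerMap, norm_pow, inv_pow, pow_sub₀ _ (norm_ne_zero_iff.2 (ht i)) (hke i).le]
    rw [← h1]
    have h2 : ‖powerMap k w i * c w‖ = ‖f w‖ * (‖powerMap k w i‖ * ‖w i‖⁻¹ ^ e i *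
        ∏ j ∈ Finset.univ.erase i, ‖w j‖⁻¹ ^ e j) := by
      simp only [c, norm_mul, norm_prod, norm_pow, norm_inv]
      rw [← Finset.mul_prod_erase _ _ (Finset.mem_univ i)]
      ring
    rw [h2]
    exact mul_le_mul_of_nonneg_right (hV w hw).1 (by positivity)
  obtain ⟨g, hg⟩ := exists_holomorphic_extension (powerMap k w₀) F
    (hnear.mono fun z hz ht => by
      obtain ⟨w, hw, rfl⟩ := hz
      exact hFd w hw ((powerMap_mem_torus hk).1 ht))
    (hnear.eventually_nhds.mono fun q hq i hqi hne => by
      have hr : ∀ j, Continuous fun z : Fin n → ℂ => ‖z j‖ ^ ((k j : ℝ)⁻¹) := fun j =>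
        (continuous_apply j).norm.rpow_const fun _ => Or.inr (by positivity)
      -- The majorant is continuous at a point of one hyperplane only, and is zero there because the
      -- exponent k_i - e_i is positive.
      have hb : ContinuousAt (fun z : Fin n → ℂ => C * ((‖z i‖ ^ ((k i : ℝ)⁻¹)) ^ (k i - e i) *
          ∏ j ∈ Finset.univ.erase i, (‖z j‖ ^ ((k j : ℝ)⁻¹))⁻¹ ^ e j)) q := by
        refine continuousAt_const.mul (((hr i).continuousAt.pow _).mul ?_)
        refine tendsto_finsetProd _ fun j hj => ?_
        refine ((hr j).continuousAt.inv₀ ?_).pow _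
        exact (Real.rpow_pos_of_pos (norm_pos_iff.2 (hne j (Finset.ne_of_mem_erase hj))) _).ne'
      have hb0 := hb.tendsto
      have hki : ((k i : ℝ)⁻¹) ≠ 0 := inv_ne_zero (Nat.cast_ne_zero.2 (hk i).ne')
      simp only [hqi, norm_zero, Real.zero_rpow hki, zero_pow (Nat.sub_pos_of_lt (hke i)).ne',
        zero_mul, mul_zero] at hb0
      refine squeeze_zero_norm' ?_ (hb0.mono_left nhdsWithin_le_nhds)
      filter_upwards [hq.filter_mono nhdsWithin_le_nhds, self_mem_nhdsWithin] with z hz ht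
      obtain ⟨w, hw, rfl⟩ := hz
      exact hbound w hw ((powerMap_mem_torus hk).1 ht) i)
  refine ⟨g, hg.mono fun z hz => hz.1, ?_⟩
  have hgw : ∀ᶠ w in 𝓝 w₀, DifferentiableAt ℂ g (powerMap k w) ∧
      (powerMap k w ∈ torus n → g (powerMap k w) = F (powerMap k w)) :=
    (continuous_powerMap k).continuousAt.eventually hg
  obtain ⟨O, hO, hOo, hwO⟩ := eventually_nhds_iff.1 (hgw.and (hVo.eventually_mem hwV))
  have heq : Set.EqOn f (fun w => g (powerMap k w) * ∏ i, w i ^ e i) O := by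
    refine eqOn_of_dense (dense_torus n) hOo
      (fun w hw => (hf w (hV w (hO w hw).2).2).continuousAt.continuousWithinAt)
      (fun w hw => (ContinuousAt.mul ((hO w hw).1.1.continuousAt.comp
        (continuous_powerMap k).continuousAt) ?_).continuousWithinAt) fun w hw ht => ?_
    · exact (continuous_finsetProd _ fun i _ => (continuous_apply i).pow _).continuousAt
    · rw [(hO w hw).1.2 ((powerMap_mem_torus hk).2 ht), hF w (hO w hw).2 ht, mul_assoc,
        ← Finset.prod_mul_distrib]
      rw [Finset.prod_eq_one, mul_one]
      intro i _
      rw [← mul_pow, inv_mul_cancel₀ (ht i), one_pow]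
  exact (hOo.eventually_mem hwO).mono heq

end Power

/-! ### Kummer coordinates and the comparison of frames. -/

section Kummer

variable {n m : ℕ} {X : Type*} [TopologicalSpace X] [ChartedSpace (Fin n → ℂ) X]
  {D : SmoothOrbifoldDivisor n X} {Y : Type*} [TopologicalSpace Y] [ChartedSpace (Fin n → ℂ) Y]
  {G : Type*} [Group G] [MulAction G Y] (K : KawamataCover D Y G)
  {ψ : OpenPartialHomeomorph Y (Fin n → ℂ)} {φ : OpenPartialHomeomorph X (Fin n → ℂ)}
  {label : Fin n → Option (Fin D.numComp)} {k : Fin n → ℕ}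

open SmoothOrbifoldDivisor

theorem prod_comp_eq_prod_pow {ι κ : Type*} [Fintype ι] [Fintype κ] [DecidableEq κ]
    (h : ι → κ) (g : κ → ℂ) : ∏ a, g (h a) = ∏ i, g i ^ Fintype.card {a // h a = i} := by
  rw [Finset.prod_comp g h]
  refine Finset.prod_subset_one_on_sdiff (Finset.subset_univ _) ?_ ?_
  · intro i hi
    have : IsEmpty {a // h a = i} := ⟨fun a => (Finset.mem_sdiff.1 hi).2
      (Finset.mem_image.2 ⟨a, Finset.mem_univ _, a.2⟩)⟩
    rw [Fintype.card_eq_zero, pow_zero]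
  · intro i _
    rw [Fintype.card_subtype]

namespace KawamataCover

/-- The pullback by `π` of the differential of the `i`-th coordinate of the chart `φ`. -/
noncomputable def pullbackCoord (φ : OpenPartialHomeomorph X (Fin n → ℂ)) (i : Fin n) (y : Y) :
    TangentSpace 𝓘(ℂ, Fin n → ℂ) y →L[ℂ] ℂ :=
  (dcoord φ i (K.toFun y)).comp (mfderiv 𝓘(ℂ, Fin n → ℂ) 𝓘(ℂ, Fin n → ℂ) K.toFun y)

variable {K}

theorem pullbackCoord_eq_differential (hφ : φ ∈ IsManifold.maximalAtlas 𝓘(ℂ, Fin n → ℂ) ω X)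
    {y : Y} (hy : K.toFun y ∈ φ.source) (i : Fin n) :
    K.pullbackCoord φ i y = differential (fun z => φ (K.toFun z) i) y :=
  (mfderiv_comp y (mdifferentiableAt_coord hφ hy i) (K.holomorphic y)).symm

theorem pullbackCoord_eq_smul (hk : IsKummerPair D K.toFun ψ φ label k) {y : Y}
    (hy : y ∈ ψ.source) (i : Fin n) :
    K.pullbackCoord φ i y = (k i * ψ y i ^ (k i - 1)) • dcoord ψ i y := by
  rw [pullbackCoord_eq_differential hk.adapted.mem_atlas (hk.mapsTo hy)]
  have h1 : differential (n := n) (fun z => φ (K.toFun z) i) y =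
      differential (fun z => ψ z i ^ k i) y := by
    refine differential_congr ?_
    filter_upwards [ψ.open_source.eventually_mem hy] with z hz using hk.kummer z hz i
  let pr : (Fin n → ℂ) →L[ℂ] ℂ := ContinuousLinearMap.proj i
  have h2 : HasFDerivAt (fun w : Fin n → ℂ => w i ^ k i) ((k i * ψ y i ^ (k i - 1) : ℂ) • pr)
      (ψ y) :=
    (hasDerivAt_pow (k i) (ψ y i)).comp_hasFDerivAt (f := pr) (ψ y) pr.hasFDerivAt
  rw [h1, differential_comp_chart_eq_sum (F := fun w => w i ^ k i) hk.mem_atlas hy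
    h2.differentiableAt, h2.fderiv]
  rw [Finset.sum_eq_single i]
  · simp [pr]
  · intro j _ hj
    simp only [pr, smul_apply, ContinuousLinearMap.proj_apply,
      Pi.single_eq_of_ne hj.symm, smul_zero]
    exact zero_smul ℂ (dcoord ψ j y)
  · simp

/-- The order `kᵢ cᵢ` of the pole of the `i`-th generator of `π^*Ω¹(X, D)`. -/
def coframeOrder (D : SmoothOrbifoldDivisor n X) (label : Fin n → Option (Fin D.numComp))
    (k : Fin n → ℕ) (i : Fin n) : ℕ :=
  ⌊(k i : ℚ) * D.weight label i⌋₊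

theorem coframe_eq (i : Fin n) (y : Y) :
    K.coframe ψ φ label k i y = (ψ y i)⁻¹ ^ coframeOrder D label k i • K.pullbackCoord φ i y :=
  rfl

/-- The denominator of c_i divides k_i, so k_i c_i is a natural number and its floor loses nothing.
-/
theorem coframeOrder_eq (hk : IsKummerPair D K.toFun ψ φ label k) (i : Fin n) :
    (coframeOrder D label k i : ℚ) = k i * D.weight label i := by
  obtain ⟨c, hc⟩ := hk.den_dvd i
  have h0 := weight_nonneg label i
  have h1 : (k i : ℚ) * D.weight label i = (c * (D.weight label i).num.toNat : ℕ) := by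
    have hnum : ((D.weight label i).num.toNat : ℤ) = (D.weight label i).num :=
      Int.toNat_of_nonneg (Rat.num_nonneg.2 h0)
    have hnum' : ((D.weight label i).num.toNat : ℚ) = ((D.weight label i).num : ℚ) := by
      exact_mod_cast congrArg (Int.cast (R := ℚ)) hnum
    have hden : D.weight label i * (D.weight label i).den = (D.weight label i).num :=
      Rat.mul_den_eq_num _
    rw [hc]
    push_cast
    rw [hnum']
    linear_combination (c : ℚ) * hden
  rw [coframeOrder, h1, Nat.floor_natCast]

/-- The order of vanishing along `{yᵢ = 0}` of the pullback of `frame φ label h` with respect to the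
tensor product of the generators of `π^*Ω¹(X, D)`. -/
def excess (D : SmoothOrbifoldDivisor n X) (label : Fin n → Option (Fin D.numComp))
    (k : Fin n → ℕ) (h : Fin m → Fin n) (i : Fin n) : ℕ :=
  Fintype.card {a // h a = i} * coframeOrder D label k i - k i * poleOrder (D := D) label h i

/-- Multiplying ⌊m_i c_i⌋ ≤ m_i c_i by k_i shows that the natural subtraction in `excess` is not
truncated. -/
theorem excess_add (hk : IsKummerPair D K.toFun ψ φ label k) (h : Fin m → Fin n) (i : Fin n) :
    excess D label k h i + k i * poleOrder (D := D) label h i =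
      Fintype.card {a // h a = i} * coframeOrder D label k i := by
  refine Nat.sub_add_cancel ?_
  have h1 : (poleOrder (D := D) label h i : ℚ) ≤
      (Fintype.card {a // h a = i} : ℚ) * D.weight label i :=
    Nat.floor_le (mul_nonneg (Nat.cast_nonneg _) (weight_nonneg _ _))
  have h2 : ((k i * poleOrder (D := D) label h i : ℕ) : ℚ) ≤
      (Fintype.card {a // h a = i} * coframeOrder D label k i : ℕ) := by
    push_cast
    rw [coframeOrder_eq hk]
    have := mul_le_mul_of_nonneg_left h1 (Nat.cast_nonneg (α := ℚ) (k i))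
    linarith
  exact_mod_cast h2

/-- The excess is k_i times the fractional part of m_i c_i. This strict bound is what makes
invariant coefficients descend without poles. -/
theorem excess_lt (hk : IsKummerPair D K.toFun ψ φ label k) (h : Fin m → Fin n) (i : Fin n) :
    excess D label k h i < k i := by
  have h1 : (Fintype.card {a // h a = i} : ℚ) * D.weight label i <
      poleOrder (D := D) label h i + 1 := Nat.lt_floor_add_one _
  have h2 : ((Fintype.card {a // h a = i} * coframeOrder D label k i : ℕ) : ℚ) <
      (k i + k i * poleOrder (D := D) label h i : ℕ) := by
    push_cast
    rw [coframeOrder_eq hk]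
    have := mul_lt_mul_of_pos_left h1 (Nat.cast_pos (α := ℚ).2 (hk.exponent_pos i))
    linarith
  have h3 : Fintype.card {a // h a = i} * coframeOrder D label k i <
      k i + k i * poleOrder (D := D) label h i := by exact_mod_cast h2
  rw [← excess_add hk] at h3
  omega

theorem kummer_powerMap (hk : IsKummerPair D K.toFun ψ φ label k) {y : Y} (hy : y ∈ ψ.source) :
    φ (K.toFun y) = powerMap k (ψ y) := funext fun i => hk.kummer y hy i

theorem notMem_support_iff (hk : IsKummerPair D K.toFun ψ φ label k) {y : Y} (hy : y ∈ ψ.source) :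
    y ∉ K.support ↔ ∀ i j, label i = some j → ψ y i ≠ 0 := by
  have h1 : y ∈ K.support ↔ K.toFun y ∈ D.support := Iff.rfl
  rw [h1, IsAdapted.mem_support_iff hk.adapted (hk.mapsTo hy)]
  simp only [hk.kummer y hy, pow_eq_zero_iff (hk.exponent_pos _).ne']
  push Not
  rfl

theorem notMem_support_of_torus (hk : IsKummerPair D K.toFun ψ φ label k) {y : Y}
    (hy : y ∈ ψ.source) (ht : ψ y ∈ torus n) : y ∉ K.support :=
  (notMem_support_iff hk hy).2 fun i _ _ => ht i

theorem tensorOf_coframe (h : Fin m → Fin n) (y : Y) :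
    (tensorOf fun a => K.coframe ψ φ label k (h a) y) =
      (∏ i, (ψ y i)⁻¹ ^ (Fintype.card {a // h a = i} * coframeOrder D label k i)) •
        tensorOf fun a => K.pullbackCoord φ (h a) y := by
  simp only [coframe_eq]
  rw [tensorOf_smul (fun a => (ψ y (h a))⁻¹ ^ coframeOrder D label k (h a)),
    prod_comp_eq_prod_pow h fun i => (ψ y i)⁻¹ ^ coframeOrder D label k i]
  congr 1
  exact Finset.prod_congr rfl fun i _ => by rw [← pow_mul, mul_comm]

theorem frame_compContinuousLinearMap (h : Fin m → Fin n) (y : Y) :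
    (D.frame φ label h (K.toFun y)).compContinuousLinearMap
        (fun _ => mfderiv 𝓘(ℂ, Fin n → ℂ) 𝓘(ℂ, Fin n → ℂ) K.toFun y) =
      (∏ i, (φ (K.toFun y) i)⁻¹ ^ poleOrder (D := D) label h i) •
        tensorOf fun a => K.pullbackCoord φ (h a) y := by
  ext v
  simp [frame_eq, tensorOf_apply, pullbackCoord]

theorem frame_compContinuousLinearMap_eq_coframe (hk : IsKummerPair D K.toFun ψ φ label k) {y : Y}
    (hy : y ∈ ψ.source) (hys : y ∉ K.support) (h : Fin m → Fin n) :
    (D.frame φ label h (K.toFun y)).compContinuousLinearMap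
        (fun _ => mfderiv 𝓘(ℂ, Fin n → ℂ) 𝓘(ℂ, Fin n → ℂ) K.toFun y) =
      (∏ i, ψ y i ^ excess D label k h i) •
        tensorOf fun a => K.coframe ψ φ label k (h a) y := by
  rw [frame_compContinuousLinearMap, tensorOf_coframe, smul_smul, ← Finset.prod_mul_distrib]
  congr 1
  refine Finset.prod_congr rfl fun i _ => ?_
  rw [hk.kummer y hy i, ← excess_add hk]
  rcases hi : label i with _ | j
  · have h1 : excess D label k h i = 0 := by
      simp [excess, coframeOrder, weight_of_none hi]
    simp [h1, poleOrder_of_none hi]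
  · have h0 := (notMem_support_iff hk hy).1 hys i j hi
    rw [pow_add, ← mul_assoc, ← mul_pow, mul_inv_cancel₀ h0, one_pow, one_mul, pow_mul, inv_pow,
      inv_pow, inv_pow]

/-- On the torus π^*dx_i is the nonzero multiple k_i y_i^{k_i - 1} of dy_i. -/
theorem pullbackCoord_independent [IsManifold 𝓘(ℂ, Fin n → ℂ) ω Y]
    (hk : IsKummerPair D K.toFun ψ φ label k) {y : Y}
    (hy : y ∈ ψ.source) (ht : ψ y ∈ torus n) {c : (Fin m → Fin n) → ℂ}
    (h : ∑ h, c h • tensorOf (fun a => K.pullbackCoord φ (h a) y) = 0) (a : Fin m → Fin n) :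
    c a = 0 := by
  simp only [pullbackCoord_eq_smul hk hy] at h
  have h1 : ∀ b : Fin m → Fin n,
      (tensorOf fun a => (k (b a) * ψ y (b a) ^ (k (b a) - 1) : ℂ) • dcoord ψ (b a) y) =
        (∏ a, (k (b a) * ψ y (b a) ^ (k (b a) - 1) : ℂ)) • tensorOf fun a => dcoord ψ (b a) y :=
    fun b => tensorOf_smul (fun a => (k (b a) * ψ y (b a) ^ (k (b a) - 1) : ℂ)) _
  simp only [h1, smul_smul] at h
  have h2 := eq_zero_of_sum_smul_tensorOf_dcoord hk.mem_atlas hy h a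
  refine (mul_eq_zero.1 h2).resolve_right (Finset.prod_ne_zero_iff.2 fun b _ => ?_)
  exact mul_ne_zero (Nat.cast_ne_zero.2 (hk.exponent_pos _).ne') (pow_ne_zero _ (ht _))

/-- `π` is open. -/
theorem eventually_exists_lift (hk : IsKummerPair D K.toFun ψ φ label k) {y : Y}
    (hy : y ∈ ψ.source) {N : Set Y} (hN : N ∈ 𝓝 y) :
    ∀ᶠ x in 𝓝 (K.toFun y), ∃ z ∈ N, z ∈ ψ.source ∧ K.toFun z = x := by
  obtain ⟨O, hO, hOo, hyO⟩ := mem_nhds_iff.1 (Filter.inter_mem hN (ψ.open_source.mem_nhds hy))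
  have h1 : IsOpen (powerMap k '' (ψ '' O)) := isOpenMap_powerMap hk.exponent_pos _
    (ψ.isOpen_image_of_subset_source hOo fun z hz => (hO hz).2)
  have h2 : ∀ᶠ x in 𝓝 (K.toFun y), φ x ∈ powerMap k '' (ψ '' O) :=
    (φ.continuousAt (hk.mapsTo hy)).eventually
      (h1.eventually_mem (by rw [kummer_powerMap hk hy]; exact ⟨_, ⟨y, hyO, rfl⟩, rfl⟩))
  filter_upwards [h2, φ.open_source.eventually_mem (hk.mapsTo hy)] with x hx hxs
  obtain ⟨_, ⟨z, hz, rfl⟩, hzx⟩ := hx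
  refine ⟨z, (hO hz).1, (hO hz).2, φ.injOn (hk.mapsTo (hO hz).2) hxs ?_⟩
  rw [kummer_powerMap hk (hO hz).2, hzx]

end KawamataCover

end Kummer

/-! ### Invariance and injectivity of the pullback. -/

section Pullback

variable {n m : ℕ} {X : Type*} [TopologicalSpace X] [ChartedSpace (Fin n → ℂ) X]
  {D : SmoothOrbifoldDivisor n X} {Y : Type*} [TopologicalSpace Y] [ChartedSpace (Fin n → ℂ) Y]
  {G : Type*} [Group G] [MulAction G Y] {K : KawamataCover D Y G}
  {ψ : OpenPartialHomeomorph Y (Fin n → ℂ)} {φ : OpenPartialHomeomorph X (Fin n → ℂ)}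
  {label : Fin n → Option (Fin D.numComp)} {k : Fin n → ℕ}

open SmoothOrbifoldDivisor

namespace KawamataCover

theorem pullback_apply {U : Opens X} (s : TensorField n m D.support U)
    (y : {y : Y // y ∈ K.preimage U ∧ y ∉ K.support}) :
    K.pullback m U s y = (s ⟨K.toFun y, y.2⟩).compContinuousLinearMap
      (fun _ => mfderiv 𝓘(ℂ, Fin n → ℂ) 𝓘(ℂ, Fin n → ℂ) K.toFun y) := rfl

theorem toFun_smul (g : G) (y : Y) : K.toFun (g • y) = K.toFun y :=
  ((K.eq_iff_orbit y (g • y)).2 ⟨g, rfl⟩).symm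

theorem mfderiv_toFun_smul (g : G) (y : Y) (v : TangentSpace 𝓘(ℂ, Fin n → ℂ) y) :
    (mfderiv 𝓘(ℂ, Fin n → ℂ) 𝓘(ℂ, Fin n → ℂ) K.toFun (g • y)
      (mfderiv 𝓘(ℂ, Fin n → ℂ) 𝓘(ℂ, Fin n → ℂ) (fun z : Y => g • z) y v) : Fin n → ℂ) =
      mfderiv 𝓘(ℂ, Fin n → ℂ) 𝓘(ℂ, Fin n → ℂ) K.toFun y v := by
  have h1 := mfderiv_comp y (K.holomorphic (g • y)) (K.smul_holomorphic g y)
  have h2 : K.toFun ∘ (fun z : Y => g • z) = K.toFun := funext fun z => toFun_smul g z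
  rw [h2] at h1
  exact (congrArg (fun L => L v) h1).symm

/-- All tangent spaces are definitionally ℂⁿ, so values at propositionally equal base points can be
compared on the same vectors without transport. -/
theorem tensorField_apply_congr {U : Opens X} (s : TensorField n m D.support U) {x x' : X}
    (h : x = x') (hx : x ∈ U ∧ x ∉ D.support) (hx' : x' ∈ U ∧ x' ∉ D.support)
    (w : Fin m → Fin n → ℂ) :
    (s ⟨x, hx⟩ : CoTensor n m x) w = (s ⟨x', hx'⟩ : CoTensor n m x') w := by
  subst h; rfl

theorem pullback_isInvariant {U : Opens X} (s : TensorField n m D.support U) :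
    K.IsInvariant (K.pullback m U s) := by
  intro g y hy hgy
  ext v
  refine (tensorField_apply_congr s (toFun_smul g y) hgy hy _).trans ?_
  exact congrArg (fun w : Fin m → Fin n → ℂ => (s ⟨K.toFun y, hy⟩ : CoTensor n m (K.toFun y)) w)
    (funext fun a => mfderiv_toFun_smul g y (v a))

theorem locallyGenerated_pullback (hk : IsKummerPair D K.toFun ψ φ label k) {U : Opens X}
    {s : TensorField n m D.support U} {y : Y} (hy : y ∈ ψ.source)
    (hs : LocallyGenerated (fun h : Fin m → Fin n => D.frame φ label h) s (K.toFun y)) :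
    LocallyGenerated (Z := K.support) (U := K.preimage U)
      (fun (h : Fin m → Fin n) z => tensorOf fun a => K.coframe ψ φ label k (h a) z)
      (K.pullback m U s) y := by
  obtain ⟨f, hf⟩ := hs
  refine ⟨fun h z => f h (K.toFun z) * ∏ i, ψ z i ^ excess D label k h i, ?_⟩
  filter_upwards [K.proper.continuous.continuousAt.eventually hf,
    ψ.open_source.eventually_mem hy] with z hz hzs
  refine ⟨fun h => ((hz.1 h).comp z (K.holomorphic z)).mul
    (mdifferentiableAt_comp_chart (F := fun w => ∏ i, w i ^ excess D label k h i) hk.mem_atlas hzs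
      (differentiableAt_finset_prod _ fun i => (differentiableAt_apply i _).fun_pow _)), fun hzU => ?_⟩
  rw [pullback_apply, hz.2 hzU, sum_smul_compContinuousLinearMap]
  refine Finset.sum_congr rfl fun h _ => ?_
  rw [frame_compContinuousLinearMap_eq_coframe hk hzs hzU.2, smul_smul]

theorem pullback_mem_invariantTensors {U : Opens X} {s : TensorField n m D.support U}
    (hs : s ∈ D.integralTensors m U) : K.pullback m U s ∈ K.invariantTensors m U :=
  ⟨fun _ _ _ _ hk _ hy hyU => locallyGenerated_pullback hk hy
    (hs _ _ hk.adapted _ (hk.mapsTo hy) hyU), pullback_isInvariant s⟩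

/-- Openness of `π` lifts every nearby point into the Kummer chart. Over the torus, independence of
the pulled back forms kills the coefficients, and density does the rest. -/
theorem eq_zero_of_pullback_eq_zero [IsManifold 𝓘(ℂ, Fin n → ℂ) ω X]
    [IsManifold 𝓘(ℂ, Fin n → ℂ) ω Y] {U : Opens X} {s : TensorField n m D.support U}
    (hs : s ∈ D.integralTensors m U) (h0 : K.pullback m U s = 0) : s = 0 := by
  funext x
  obtain ⟨y, hy⟩ := K.surjective x
  obtain ⟨ψ, φ, label, k, hk, hys⟩ := K.locally_kummer y
  have hxφ : (x : X) ∈ φ.source := hy ▸ hk.mapsTo hys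
  obtain ⟨f, hf⟩ := hs φ label hk.adapted x hxφ x.2.1
  have hlift : ∀ᶠ x' in 𝓝 (x : X), ∃ z ∈ (Set.univ : Set Y), z ∈ ψ.source ∧ K.toFun z = x' := by
    rw [← hy]
    exact eventually_exists_lift hk hys univ_mem
  have hzero : ∀ h, f h x = 0 := fun h => by
    refine (eventuallyEq_of_torus φ hxφ (hf.mono fun z hz => (hz.1 h).continuousAt)
      (g := fun _ => 0) (Eventually.of_forall fun _ => continuousAt_const) ?_).self_of_nhds
    filter_upwards [hf, hlift, U.isOpen.eventually_mem x.2.1] with x' hx' hl hxU ht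
    obtain ⟨z, -, hzs, rfl⟩ := hl
    have hzt : ψ z ∈ torus n := by
      rwa [kummer_powerMap hk hzs, powerMap_mem_torus hk.exponent_pos] at ht
    have hzU : z ∈ K.preimage U ∧ z ∉ K.support := ⟨hxU, notMem_support_of_torus hk hzs hzt⟩
    have h1 : K.pullback m U s ⟨z, hzU⟩ = 0 := by rw [h0]; rfl
    rw [pullback_apply, hx'.2 hzU, sum_smul_compContinuousLinearMap] at h1
    simp only [frame_compContinuousLinearMap, smul_smul] at h1
    have h2 := pullbackCoord_independent hk hzs hzt h1 h
    exact (mul_eq_zero.1 h2).resolve_right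
      (IsAdapted.pole_ne_zero hk.adapted (hk.mapsTo hzs) hzU.2 h)
  rw [hf.self_of_nhds.2 x.2]
  exact Finset.sum_eq_zero fun h _ => by rw [hzero h]; exact zero_smul ℂ (D.frame φ label h x)

theorem injOn_pullback [IsManifold 𝓘(ℂ, Fin n → ℂ) ω X]
    [IsManifold 𝓘(ℂ, Fin n → ℂ) ω Y] (U : Opens X) :
    Set.InjOn (K.pullback m U) (D.integralTensors m U) := fun s hs s' hs' h =>
  sub_eq_zero.1 (eq_zero_of_pullback_eq_zero (K := K) (Submodule.sub_mem _ hs hs')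
    (by rw [map_sub, h, sub_self]))

theorem pullbackCoord_smul (hφ : φ ∈ IsManifold.maximalAtlas 𝓘(ℂ, Fin n → ℂ) ω X) (g : G)
    {y : Y} (hy : K.toFun y ∈ φ.source) (i : Fin n) :
    (K.pullbackCoord φ i (g • y)).comp
      (mfderiv 𝓘(ℂ, Fin n → ℂ) 𝓘(ℂ, Fin n → ℂ) (fun z : Y => g • z) y) =
      K.pullbackCoord φ i y := by
  have hgy : K.toFun (g • y) ∈ φ.source := by rwa [toFun_smul]
  rw [pullbackCoord_eq_differential hφ hgy, pullbackCoord_eq_differential hφ hy]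
  have hd : MDifferentiableAt 𝓘(ℂ, Fin n → ℂ) 𝓘(ℂ, ℂ) (fun z => φ (K.toFun z) i) (g • y) :=
    (mdifferentiableAt_coord hφ hgy i).comp (g • y) (K.holomorphic (g • y))
  have h1 := mfderiv_comp y hd (K.smul_holomorphic g y)
  have h2 : (fun z => φ (K.toFun z) i) ∘ (fun z : Y => g • z) = fun z => φ (K.toFun z) i :=
    funext fun z => by simp only [Function.comp_apply, toFun_smul]
  rw [h2] at h1
  exact h1.symm

/-- The coefficients of an invariant tensor in the pulled back frame agree on the fibres of `π`. -/
theorem coeff_eq_of_invariant [IsManifold 𝓘(ℂ, Fin n → ℂ) ω Y]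
    (hk : IsKummerPair D K.toFun ψ φ label k) {U : Opens X} {s : K.Pushforward m U}
    (hs : K.IsInvariant s) {y y' : Y} (hy : y ∈ ψ.source) (ht : ψ y ∈ torus n)
    (hyU : y ∈ K.preimage U ∧ y ∉ K.support) (hyU' : y' ∈ K.preimage U ∧ y' ∉ K.support)
    (hyy' : K.toFun y = K.toFun y') {c c' : (Fin m → Fin n) → ℂ}
    (hc : s ⟨y, hyU⟩ = ∑ h, c h • tensorOf fun a => K.pullbackCoord φ (h a) y)
    (hc' : s ⟨y', hyU'⟩ = ∑ h, c' h • tensorOf fun a => K.pullbackCoord φ (h a) y') : c = c' := by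
  obtain ⟨g, rfl⟩ := (K.eq_iff_orbit y y').1 hyy'
  have h1 := hs g y hyU hyU'
  rw [hc', hc, sum_smul_compContinuousLinearMap] at h1
  simp only [tensorOf_comp, pullbackCoord_smul hk.adapted.mem_atlas g (hk.mapsTo hy)] at h1
  funext h
  refine (sub_eq_zero.1 (pullbackCoord_independent hk hy ht (c := fun h => c' h - c h) ?_ h)).symm
  ext v
  have h2 := congrArg (fun t => t v) h1
  simp only [sum_apply, smul_apply, smul_eq_mul] at h2
  simp only [sum_apply, smul_apply, smul_eq_mul, sub_mul, Finset.sum_sub_distrib, h2, sub_self,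
    zero_apply]

end KawamataCover

end Pullback

/-! ### Descent of invariant tensors and gluing. -/

section Descent

variable {n m : ℕ} {X : Type*} [TopologicalSpace X] [ChartedSpace (Fin n → ℂ) X]
  {D : SmoothOrbifoldDivisor n X} {Y : Type*} [TopologicalSpace Y] [ChartedSpace (Fin n → ℂ) Y]
  {G : Type*} [Group G] [MulAction G Y] {K : KawamataCover D Y G}
  {ψ : OpenPartialHomeomorph Y (Fin n → ℂ)} {φ : OpenPartialHomeomorph X (Fin n → ℂ)}
  {label : Fin n → Option (Fin D.numComp)} {k : Fin n → ℕ}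

open SmoothOrbifoldDivisor

/-- The restriction of a tensor field to a smaller open set. -/
def TensorField.restrict {M : Type*} [TopologicalSpace M] [ChartedSpace (Fin n → ℂ) M] {Z : Set M}
    {U V : Opens M} (h : V ≤ U) (s : TensorField n m Z U) : TensorField n m Z V :=
  fun x => s ⟨x, h x.2.1, x.2.2⟩

theorem restrict_mem_integralTensors {U V : Opens X} (h : V ≤ U) {s : TensorField n m D.support U}
    (hs : s ∈ D.integralTensors m U) : s.restrict h ∈ D.integralTensors m V :=
  fun φ label hφ x hx hxV => (hs φ label hφ x hx (h hxV)).congr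
    (Eventually.of_forall fun _ hz => ⟨⟨h hz.1, hz.2⟩, rfl⟩)

namespace KawamataCover

theorem prod_inv_pow_excess (hk : IsKummerPair D K.toFun ψ φ label k) {w : Fin n → ℂ}
    (hw : w ∈ torus n) (h : Fin m → Fin n) :
    ∏ i, (w i)⁻¹ ^ excess D label k h i =
      (∏ i, (w i)⁻¹ ^ (Fintype.card {a // h a = i} * coframeOrder D label k i)) *
        ∏ i, powerMap k w i ^ poleOrder (D := D) label h i := by
  rw [← Finset.prod_mul_distrib]
  refine Finset.prod_congr rfl fun i _ => ?_
  rw [← excess_add hk, pow_add, powerMap, ← pow_mul, mul_assoc, ← mul_pow,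
    inv_mul_cancel₀ (hw i), one_pow, mul_one]

theorem exists_local_descent [IsManifold 𝓘(ℂ, Fin n → ℂ) ω Y] {U : Opens X}
    {s : K.Pushforward m U} (hs : s ∈ K.invariantTensors m U) {x : X} (hx : x ∈ U) :
    ∃ (W : Opens X) (hW : W ≤ U) (t : TensorField n m D.support W), x ∈ W ∧
      t ∈ D.integralTensors m W ∧ ∀ y (hy : y ∈ K.preimage W ∧ y ∉ K.support),
        K.pullback m W t ⟨y, hy⟩ = s ⟨y, hW hy.1, hy.2⟩ := by
  obtain ⟨y₀, rfl⟩ := K.surjective x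
  obtain ⟨ψ, φ, label, k, hk, hy₀⟩ := K.locally_kummer y₀
  obtain ⟨f, hf⟩ := hs.1 ψ φ label k hk y₀ hy₀ hx
  obtain ⟨O, hO, hOo, hyO⟩ := eventually_nhds_iff.1
    (hf.and ((ψ.open_source.eventually_mem hy₀).and ((K.preimage U).isOpen.eventually_mem hx)))
  have hcoeff : ∀ y ∈ O, ∀ hyU : y ∈ K.preimage U ∧ y ∉ K.support, s ⟨y, hyU⟩ =
      ∑ h, (f h y * ∏ i, (ψ y i)⁻¹ ^ (Fintype.card {a // h a = i} * coframeOrder D label k i)) •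
        tensorOf fun a => K.pullbackCoord φ (h a) y := fun y hy hyU => by
    refine ((hO y hy).1.2 hyU).trans (Finset.sum_congr rfl fun h _ => ?_)
    beta_reduce
    rw [tensorOf_coframe, smul_smul]
  -- Invariance makes the coefficients in the frame of the π^*dx_i constant on fibres. Multiplying
  -- by the pole factor of the frame, a function of x, turns y^{-m_i k_i c_i} into y^{-e_i}, the
  -- form required here.
  have hdescent := fun h : Fin m → Fin n => exists_descent (fun i => excess_lt hk h i)
    ((ψ.isOpen_image_of_subset_source hOo fun y hy => (hO y hy).2.1).mem_nhds ⟨y₀, hyO, rfl⟩)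
    (f := fun w => f h (ψ.symm w)) (by
      rintro _ ⟨y, hy, rfl⟩
      have hys := (hO y hy).2.1
      exact differentiableAt_comp_chart_symm hk.mem_atlas (ψ.map_source hys)
        (by rw [ψ.left_inv hys]; exact (hO y hy).1.1 h)) (by
      rintro _ ⟨y, hy, rfl⟩ _ ⟨y', hy', rfl⟩ ht ht' heq
      have hys := (hO y hy).2.1
      have hys' := (hO y' hy').2.1
      have hyy' : K.toFun y = K.toFun y' := φ.injOn (hk.mapsTo hys) (hk.mapsTo hys')
        (by rw [kummer_powerMap hk hys, kummer_powerMap hk hys', heq])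
      have hyU : y ∈ K.preimage U ∧ y ∉ K.support :=
        ⟨(hO y hy).2.2, notMem_support_of_torus hk hys ht⟩
      have hyU' : y' ∈ K.preimage U ∧ y' ∉ K.support :=
        ⟨(hO y' hy').2.2, notMem_support_of_torus hk hys' ht'⟩
      have h1 := congrFun (coeff_eq_of_invariant hk hs.2 hys ht hyU hyU' hyy'
        (hcoeff y hy hyU) (hcoeff y' hy' hyU')) h
      rw [ψ.left_inv hys, ψ.left_inv hys', prod_inv_pow_excess hk ht,
        prod_inv_pow_excess hk ht', ← heq, ← mul_assoc, ← mul_assoc, h1])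
  choose g hgd hg using hdescent
  have hlift := eventually_exists_lift hk hy₀
    (((ψ.continuousAt hy₀).eventually (eventually_all.2 hg)).and (hOo.eventually_mem hyO))
  have hgd' : ∀ᶠ x in 𝓝 (K.toFun y₀), ∀ h, DifferentiableAt ℂ (g h) (φ x) := by
    refine (φ.continuousAt (hk.mapsTo hy₀)).eventually (eventually_all.2 fun h => ?_)
    rw [kummer_powerMap hk hy₀]
    exact hgd h
  obtain ⟨W, hW, hWo, hxW⟩ := eventually_nhds_iff.1 (hlift.and (hgd'.and
    ((φ.open_source.eventually_mem (hk.mapsTo hy₀)).and (U.isOpen.eventually_mem hx))))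
  let W' : Opens X := ⟨W, hWo⟩
  let c : (Fin m → Fin n) → holo n W' := fun h => ⟨fun x => g h (φ x), fun x =>
    mdifferentiableAt_restrict_iff.2 (mdifferentiableAt_comp_chart hk.adapted.mem_atlas
      (hW x x.2).2.2.1 ((hW x x.2).2.1 h))⟩
  have hWU : W' ≤ U := fun x hx => (hW x hx).2.2.2
  refine ⟨W', hWU, ∑ h, c h • D.frameOn φ label h W', hxW,
    mem_integralTensors_of_locally fun x hx =>
      ⟨φ, label, hk.adapted, (hW x hx).2.2.1, locallyGenerated_of_eq_sum rfl hx⟩, ?_⟩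
  intro y hy
  -- The Kummer chart need not contain y. Some a in `G` moves y into it, and invariance of both
  -- sides reduces the equality at y to the one at a • y.
  obtain ⟨z, ⟨hz, hzO⟩, hzs, hzy⟩ := (hW _ hy.1).1
  obtain ⟨a, rfl⟩ := (K.eq_iff_orbit y z).1 hzy.symm
  have hay : a • y ∈ K.preimage W' ∧ a • y ∉ K.support :=
    ⟨(congrArg (· ∈ W) hzy).mpr hy.1, fun h => hy.2 ((congrArg (· ∈ D.support) hzy).mp h)⟩
  rw [← hs.2 a y ⟨hWU hy.1, hy.2⟩ ⟨hWU hay.1, hay.2⟩,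
    ← pullback_isInvariant (K := K) (∑ h, c h • D.frameOn φ label h W') a y hy hay]
  congr 1
  rw [pullback_apply, sum_smul_apply, sum_smul_compContinuousLinearMap,
    (hO _ hzO).1.2 ⟨hWU hay.1, hay.2⟩]
  refine Finset.sum_congr rfl fun h _ => ?_
  have h1 := hz h
  rw [ψ.left_inv hzs, ← kummer_powerMap hk hzs] at h1
  rw [h1, mul_smul, ← frame_compContinuousLinearMap_eq_coframe hk hzs hay.2]
  rfl

theorem exists_descent_of_mem_invariantTensors [IsManifold 𝓘(ℂ, Fin n → ℂ) ω X]
    [IsManifold 𝓘(ℂ, Fin n → ℂ) ω Y] {U : Opens X}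
    {s : K.Pushforward m U} (hs : s ∈ K.invariantTensors m U) :
    ∃ t ∈ D.integralTensors m U, K.pullback m U t = s := by
  choose W hWU t hxW ht hts using fun x : U => exists_local_descent hs x.2
  let T : TensorField n m D.support U := fun x => t ⟨x, x.2.1⟩ ⟨x, hxW ⟨x, x.2.1⟩, x.2.2⟩
  have hT : ∀ (x : U) z (hz : z ∈ W x ∧ z ∉ D.support),
      T ⟨z, hWU x hz.1, hz.2⟩ = t x ⟨z, hz⟩ := by
    intro x z hz
    let z' : U := ⟨z, hWU x hz.1⟩
    -- On an overlap both local descents pull back to `s`, so injectivity of the pullback forces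
    -- them to agree.
    have h1 : (t z').restrict (inf_le_left : W z' ⊓ W x ≤ W z') =
        (t x).restrict (inf_le_right : W z' ⊓ W x ≤ W x) := by
      refine injOn_pullback (K := K) (W z' ⊓ W x) (restrict_mem_integralTensors _ (ht z'))
        (restrict_mem_integralTensors _ (ht x)) (funext fun y => ?_)
      exact (hts z' y ⟨y.2.1.1, y.2.2⟩).trans (hts x y ⟨y.2.1.2, y.2.2⟩).symm
    exact congrFun h1 ⟨z, ⟨hxW z', hz.1⟩, hz.2⟩
  refine ⟨T, fun φ label hφ x hx hxU => ?_, ?_⟩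
  · refine (ht ⟨x, hxU⟩ φ label hφ x hx (hxW ⟨x, hxU⟩)).congr ?_
    filter_upwards [(W ⟨x, hxU⟩).isOpen.eventually_mem (hxW ⟨x, hxU⟩)] with z hz hzU
    exact ⟨⟨hz, hzU.2⟩, hT ⟨x, hxU⟩ z ⟨hz, hzU.2⟩⟩
  · funext y
    exact hts ⟨K.toFun y, y.2.1⟩ y ⟨hxW ⟨K.toFun y, y.2.1⟩, y.2.2⟩

theorem map_pullback_integralTensors [IsManifold 𝓘(ℂ, Fin n → ℂ) ω X]
    [IsManifold 𝓘(ℂ, Fin n → ℂ) ω Y] (U : Opens X) :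
    (D.integralTensors m U).map (K.pullback m U) = K.invariantTensors m U := by
  refine le_antisymm ?_ fun s hs => ?_
  · rintro _ ⟨s, hs, rfl⟩
    exact pullback_mem_invariantTensors hs
  · obtain ⟨t, ht, hts⟩ := exists_descent_of_mem_invariantTensors hs
    exact ⟨t, ht, hts⟩

end KawamataCover

end Descent

end Orbifold

theorem mainTheorem12 (n : ℕ)
    (X : Type*) [TopologicalSpace X] [ChartedSpace (Fin n → ℂ) X]
    [IsManifold 𝓘(ℂ, Fin n → ℂ) ω X] [T2Space X] [CompactSpace X] [ConnectedSpace X]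
    (hX : Orbifold.IsProjective n X)
    (D : Orbifold.SmoothOrbifoldDivisor n X)
    (Y : Type*) [TopologicalSpace Y] [ChartedSpace (Fin n → ℂ) Y]
    [IsManifold 𝓘(ℂ, Fin n → ℂ) ω Y] [T2Space Y] [ConnectedSpace Y]
    (G : Type*) [Group G] [Finite G] [MulAction G Y]
    (K : Orbifold.KawamataCover D Y G)
    (m : ℕ) (hm : 0 < m) :
    -- the sheaf of integral tensors is free, on the frame given by any adapted coordinates
    (∀ φ label, D.IsAdapted φ label → ∀ V : Opens X, (V : Set X) ⊆ φ.source →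
      ∀ s : Orbifold.TensorField n m D.support V, s ∈ D.integralTensors m V ↔
        ∃! f : (Fin m → Fin n) → Orbifold.holo n V,
          s = ∑ h, f h • D.frameOn φ label h V) ∧
    -- pulling back by `π` identifies it with the sheaf of invariant orbifold tensors
    ∀ U : Opens X,
      Set.InjOn (K.pullback m U) (D.integralTensors m U) ∧
        (D.integralTensors m U).map (K.pullback m U) = K.invariantTensors m U :=
  ⟨fun _ _ hφ _ hV s => Orbifold.mem_integralTensors_iff hφ hV s, fun U =>
    ⟨Orbifold.KawamataCover.injOn_pullback U,
      Orbifold.KawamataCover.map_pullback_integralTensors U⟩⟩
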